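/- Let $Q$ be a quiver with finite vertex set $Q_0$, let $I \subset \mathbb{C}Q$ be a set of relations, and let $\mathbf{d} \in \mathbb{N}^{Q_0}$ be a sincere dimension vector, i.e. $d_j \neq 0$ for all $j \in Q_0$. Let the group $\mathrm{GL}_{\mathbf{d}} = \prod_{j \in Q_0} \mathrm{GL}(d_j, \mathbb{C})$ act by base change on the space $\mathrm{Rep}(\mathbb{C}Q/I, \mathbf{d})$ of representations of $Q$ of dimension $\mathbf{d}$ that satisfy the relations $I$ (with its usual complex topology). Let $M \in \mathrm{Rep}(\mathbb{C}Q/I, \mathbf{d})$, and write $M \cong \bigoplus_{i=1}^{k} M^{(i)} \otimes V_i$, where the $M^{(i)}$ are pairwise non-isomorphic indecomposable representations and the $V_i$ are nonzero finite-dimensional vector spaces. Let $\beta^{(i)} \in \mathbb{N}^{Q_0}$ be the dimension vector of $M^{(i)}$. Then the fundamental group (at any base point) of the orbit $\mathrm{GL}_{\mathbf{d}} \cdot M$ is isomorphic to the cokernel of the map $$B : \mathbb{Z}^k \to \mathbb{Z}^{Q_0}, \qquad B = \bigl(\beta^{(i)}_j\bigr)_{j \in Q_0,\ 1 \le i \le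 k}.$$ In particular, this group is abelian, and up to isomorphism it depends only on the set of dimension vectors $\{\beta^{(1)}, \dots, \beta^{(k)}\}$: if $M'$ is a representation of $(Q, I)$ with sincere dimension vector $\mathbf{d}'$ whose indecomposable summands have the same set of dimension vectors, then the fundamental groups of $\mathrm{GL}_{\mathbf{d}} \cdot M$ and $\mathrm{GL}_{\mathbf{d}'} \cdot M'$ are isomorphic. -/

import Mathlib

open scoped Matrix

universe u v

noncomputable section

namespace QuiverRep

/-- A `ℂ`-linear combination of paths, i.e. an element of the path algebra
`ℂQ = ⨁_{a, b} e_b (ℂQ) e_a` of a quiver with finitely many vertices: the component `r a b` is the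
linear combination of the paths from `a` to `b` that occur in `r`. -/
abbrev PathAlgebraElement (Q : Type u) [Quiver.{v} Q] : Type (max u v) :=
  ∀ a b : Q, Quiver.Path a b →₀ ℂ

/-- The space `Rep(Q, d)` of representations of the quiver `Q` with dimension vector `d`: a matrix
`ℂ^{d i} → ℂ^{d j}` for every arrow from `i` to `j`. -/
def RepSpace (Q : Type u) [Quiver.{v} Q] (d : Q → ℕ) : Type (max u v) :=
  ∀ i j : Q, (i ⟶ j) → Matrix (Fin (d j)) (Fin (d i)) ℂ

/-- The usual (complex analytic) topology on `Rep(Q, d)`. -/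
instance (Q : Type u) [Quiver.{v} Q] (d : Q → ℕ) : TopologicalSpace (RepSpace Q d) :=
  inferInstanceAs
    (TopologicalSpace (∀ i j : Q, (i ⟶ j) → Matrix (Fin (d j)) (Fin (d i)) ℂ))

/-- The group `GL_d = ∏_i GL(d_i, ℂ)`. -/
abbrev GLd {Q : Type u} (d : Q → ℕ) : Type u :=
  ∀ i : Q, Matrix.GeneralLinearGroup (Fin (d i)) ℂ

/-- The base change action of `GL_d` on `Rep(Q, d)`: `(g • M)_a = g_j M_a g_i⁻¹` for `a : i ⟶ j`. -/
instance {Q : Type u} [Quiver.{v} Q] (d : Q → ℕ) : MulAction (GLd d) (RepSpace Q d) where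
  smul g M := fun i j a =>
    (g j : Matrix (Fin (d j)) (Fin (d j)) ℂ) * M i j a *
      ((g i)⁻¹ : Matrix.GeneralLinearGroup (Fin (d i)) ℂ).val
  one_smul M := by
    funext i j a
    change ((1 : Matrix.GeneralLinearGroup (Fin (d j)) ℂ) : Matrix (Fin (d j)) (Fin (d j)) ℂ) *
      M i j a * ((1 : Matrix.GeneralLinearGroup (Fin (d i)) ℂ)⁻¹).val = M i j a
    rw [inv_one, Units.val_one, Units.val_one, Matrix.one_mul, Matrix.mul_one]
  mul_smul g h M := by
    funext i j a
    change ((g j * h j : Matrix.GeneralLinearGroup (Fin (d j)) ℂ) :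
        Matrix (Fin (d j)) (Fin (d j)) ℂ) * M i j a * ((g i * h i)⁻¹).val =
      (g j).val * ((h j).val * M i j a * ((h i)⁻¹).val) * ((g i)⁻¹).val
    rw [mul_inv_rev, Units.val_mul, Units.val_mul]
    simp only [Matrix.mul_assoc]

theorem smul_apply {Q : Type u} [Quiver.{v} Q] {d : Q → ℕ} (g : GLd d) (M : RepSpace Q d)
    (i j : Q) (a : i ⟶ j) :
    (g • M) i j a = (g j).val * M i j a * ((g i)⁻¹).val :=
  rfl

/-- The linear map by which a path acts on a representation. -/
def pathMatrix {Q : Type u} [Quiver.{v} Q] {d : Q → ℕ} (M : RepSpace Q d) {a : Q} :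
    ∀ {b : Q}, Quiver.Path a b → Matrix (Fin (d b)) (Fin (d a)) ℂ
  | _, .nil => 1
  | _, .cons p e => M _ _ e * pathMatrix M p

/-- The `(a, b)`-component of the action of an element of the path algebra on a representation. -/
def relationMatrix {Q : Type u} [Quiver.{v} Q] {d : Q → ℕ} (M : RepSpace Q d)
    (r : PathAlgebraElement Q) (a b : Q) : Matrix (Fin (d b)) (Fin (d a)) ℂ :=
  (r a b).sum fun p c => c • pathMatrix M p

/-- Every element of `I ⊆ ℂQ` acts as zero on `M`. -/
def SatisfiesRelations {Q : Type u} [Quiver.{v} Q] {d : Q → ℕ} (I : Set (PathAlgebraElement Q))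
    (M : RepSpace Q d) : Prop :=
  ∀ r ∈ I, ∀ a b : Q, relationMatrix M r a b = 0

theorem pathMatrix_smul {Q : Type u} [Quiver.{v} Q] {d : Q → ℕ} (g : GLd d) (M : RepSpace Q d)
    {a b : Q} (p : Quiver.Path a b) :
    pathMatrix (g • M) p = (g b).val * pathMatrix M p * ((g a)⁻¹).val := by
  induction p with
  | nil => simp [pathMatrix]
  | @cons b c p e ih =>
    have h : ((g b)⁻¹).val * (g b).val = 1 := (g b).inv_mul
    rw [pathMatrix, pathMatrix, ih, smul_apply]
    calc (g c).val * M b c e * ((g b)⁻¹).val * ((g b).val * pathMatrix M p * ((g a)⁻¹).val)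
        = (g c).val * M b c e * (((g b)⁻¹).val * (g b).val) *
            pathMatrix M p * ((g a)⁻¹).val := by simp only [Matrix.mul_assoc]
      _ = (g c).val * (M b c e * pathMatrix M p) * ((g a)⁻¹).val := by
          rw [h]; simp only [Matrix.mul_assoc, Matrix.one_mul]

theorem SatisfiesRelations.smul {Q : Type u} [Quiver.{v} Q] {d : Q → ℕ}
    {I : Set (PathAlgebraElement Q)} {M : RepSpace Q d} (hM : SatisfiesRelations I M)
    (g : GLd d) : SatisfiesRelations I (g • M) := by
  intro r hr a b
  have h : relationMatrix (g • M) r a b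
      = (g b).val * relationMatrix M r a b * ((g a)⁻¹).val := by
    simp only [relationMatrix, Finsupp.sum, pathMatrix_smul, Matrix.mul_sum, Matrix.sum_mul,
      Matrix.mul_smul, Matrix.smul_mul]
  rw [h, hM r hr a b, Matrix.mul_zero, Matrix.zero_mul]

/-- The space `Rep(ℂQ/I, d)` of representations of the quiver with relations `(Q, I)` with dimension
vector `d`, with the topology induced from `Rep(Q, d)`. -/
abbrev Rep {Q : Type u} [Quiver.{v} Q] (I : Set (PathAlgebraElement Q)) (d : Q → ℕ) :
    Type (max u v) :=
  {M : RepSpace Q d // SatisfiesRelations I M}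

/-- The action of `GL_d` on `Rep(ℂQ/I, d)`. -/
instance {Q : Type u} [Quiver.{v} Q] (I : Set (PathAlgebraElement Q)) (d : Q → ℕ) :
    MulAction (GLd d) (Rep I d) where
  smul g M := ⟨g • M.1, M.2.smul g⟩
  one_smul M := Subtype.ext (one_smul (GLd d) M.1)
  mul_smul g h M := Subtype.ext (mul_smul g h M.1)

/-- The linear map by which an arrow acts on a representation. -/
def arrowMap {Q : Type u} [Quiver.{v} Q] {I : Set (PathAlgebraElement Q)} {d : Q → ℕ}
    (M : Rep I d) {i j : Q} (a : i ⟶ j) : (Fin (d i) → ℂ) →ₗ[ℂ] (Fin (d j) → ℂ) :=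
  (M.1 i j a).mulVecLin

/-- Two representations are isomorphic. -/
def IsIsomorphic {Q : Type u} [Quiver.{v} Q] {I : Set (PathAlgebraElement Q)} {d d' : Q → ℕ}
    (M : Rep I d) (M' : Rep I d') : Prop :=
  ∃ φ : ∀ i : Q, (Fin (d i) → ℂ) ≃ₗ[ℂ] (Fin (d' i) → ℂ),
    ∀ (i j : Q) (a : i ⟶ j) (x : Fin (d i) → ℂ),
      φ j (arrowMap M a x) = arrowMap M' a (φ i x)

/-- A family of subspaces is a subrepresentation if it is stable under all arrows. -/
def IsSubrep {Q : Type u} [Quiver.{v} Q] {I : Set (PathAlgebraElement Q)} {d : Q → ℕ}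
    (M : Rep I d) (U : ∀ i : Q, Submodule ℂ (Fin (d i) → ℂ)) : Prop :=
  ∀ (i j : Q) (a : i ⟶ j), ∀ x ∈ U i, arrowMap M a x ∈ U j

/-- A representation is indecomposable if it is nonzero and is not the direct sum of two nonzero
subrepresentations. -/
def IsIndecomposable {Q : Type u} [Quiver.{v} Q] {I : Set (PathAlgebraElement Q)} {d : Q → ℕ}
    (M : Rep I d) : Prop :=
  (∃ i, d i ≠ 0) ∧
    ∀ U W : ∀ i : Q, Submodule ℂ (Fin (d i) → ℂ),
      IsSubrep M U → IsSubrep M W → (∀ i, IsCompl (U i) (W i)) →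
        (∀ i, U i = ⊥) ∨ (∀ i, W i = ⊥)

/-- `N 0, …, N (k - 1)` are the distinct indecomposable summands of `M`, with multiplicities `m`:
they are pairwise non-isomorphic indecomposable representations, all multiplicities are positive,
and `M ≅ ⨁ i, N i ⊗ ℂ^{m i}`. -/
structure IsDecomposition {Q : Type u} [Quiver.{v} Q] {I : Set (PathAlgebraElement Q)}
    {d : Q → ℕ} (M : Rep I d) {k : ℕ} {β : Fin k → Q → ℕ} (N : ∀ i, Rep I (β i))
    (m : Fin k → ℕ) : Prop where
  indecomposable : ∀ i, IsIndecomposable (N i)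
  not_isomorphic : ∀ i i', i ≠ i' → ¬ IsIsomorphic (N i) (N i')
  mult_pos : ∀ i, 0 < m i
  iso : ∃ φ : ∀ j : Q, (Fin (d j) → ℂ) ≃ₗ[ℂ] (∀ i : Fin k, Fin (m i) → Fin (β i j) → ℂ),
    ∀ (j l : Q) (a : j ⟶ l) (x : Fin (d j) → ℂ) (i : Fin k) (s : Fin (m i)),
      φ l (arrowMap M a x) i s = arrowMap (N i) a (φ j x i s)

/-- A dimension vector is sincere if none of its entries vanishes. -/
def IsSincere {Q : Type u} (d : Q → ℕ) : Prop :=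
  ∀ i, d i ≠ 0

/-- The map `ℤ^k → ℤ^{Q_0}` with matrix `(β i j)`, whose columns are the vectors `β i`. -/
def dimensionMap {Q : Type u} {k : ℕ} (β : Fin k → Q → ℕ) : (Fin k → ℤ) →ₗ[ℤ] (Q → ℤ) :=
  (Matrix.of fun (j : Q) (i : Fin k) => (β i j : ℤ)).mulVecLin

/-- The cokernel of `dimensionMap β`. -/
abbrev DimensionCokernel {Q : Type u} {k : ℕ} (β : Fin k → Q → ℕ) : Type u :=
  (Q → ℤ) ⧸ LinearMap.range (dimensionMap β)

end QuiverRep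

end

noncomputable section

open Topology unitInterval

/-! ### Simply connected spaces -/

/-! The orbit is `GL_d / Aut M`, so the long exact homotopy sequence should read π₁(Aut M) →
π₁(GL_d) → π₁(orbit) → π₀(Aut M). Up to a unipotent part, `Aut M` is the product of the `GL(V_i)`:
it is connected with π₁ = ℤ^k, while π₁(GL_d) = ℤ^{Q_0} by sincerity. The determinant of an
automorphism at the vertex `j` is the product of its determinants χ_i on the multiplicity spaces
`V_i`, raised to the powers `β i j`. Hence the first map is `B`, and π₁ of the orbit is its
cokernel.

The proof realizes this with covering spaces. Let X = `GLCover d` consist of families of invertible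
matrices with a chosen logarithm of each determinant. It is a simply connected group
(`DetCover.simplyConnectedSpace_fin`), acting on the orbit, and the kernel of its map to `GL_d` is
the central group ℤ^{Q_0}, embedded by `centralLift`. The stabilizer of `M` in X is K · ℤ^{Q_0},
where K = `stabComponent` requires the logarithms of the determinants to be the `β`-combinations of
logarithms of the χ_i. This K is path connected, relatively open in the stabilizer, and meets
ℤ^{Q_0} exactly in the image of `B`. So X/K is simply connected and covers the orbit with deck group
coker `B` (`HasLocalSection.nonempty_fundamentalGroup_equiv`).

Three inputs carry the argument. `exists_continuous_hom` gives local sections of the orbit map by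
linear algebra, without Lie theory or homogeneous space theorems. Fitting's lemma
(`IsIndecomposable.exists_eigenvalue`) makes the action on the multiplicity spaces multiplicative.
The determinant formula `det_eq_prod_char` follows from traces of powers, so no structure theory of
the radical of End(M) is needed. -/

/-- A retract of a simply connected space is simply connected. -/
theorem SimplyConnectedSpace.of_retract {X Y : Type*} [TopologicalSpace X] [TopologicalSpace Y]
    [SimplyConnectedSpace Y] (f : X → Y) (g : Y → X) (hf : Continuous f) (hg : Continuous g)
    (h : ∀ x, g (f x) = x) : SimplyConnectedSpace X := by
  have hpc : PathConnectedSpace X :=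
    (Function.LeftInverse.surjective h).pathConnectedSpace hg
  refine simply_connected_iff_loops_nullhomotopic.2 ⟨hpc, fun x γ => ?_⟩
  have key := (SimplyConnectedSpace.paths_homotopic (γ.map hf) (Path.refl (f x))).map ⟨g, hg⟩
  have key' := key.pathCast (h x).symm (h x).symm
  convert key' using 1
  · ext t; simp [h]
  · ext t; simp [h]

theorem SimplyConnectedSpace.of_homeomorph {X Y : Type*} [TopologicalSpace X] [TopologicalSpace Y]
    [SimplyConnectedSpace Y] (e : X ≃ₜ Y) : SimplyConnectedSpace X :=
  .of_retract e e.symm e.continuous e.symm.continuous e.symm_apply_apply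

instance SimplyConnectedSpace.prod {X Y : Type*} [TopologicalSpace X] [TopologicalSpace Y]
    [SimplyConnectedSpace X] [SimplyConnectedSpace Y] : SimplyConnectedSpace (X × Y) := by
  refine simply_connected_iff_paths_homotopic'.2 ⟨inferInstance, fun {x y} p q => ?_⟩
  obtain ⟨F⟩ := SimplyConnectedSpace.paths_homotopic (p.map continuous_fst) (q.map continuous_fst)
  obtain ⟨G⟩ := SimplyConnectedSpace.paths_homotopic (p.map continuous_snd) (q.map continuous_snd)
  exact ⟨Path.Homotopic.prodHomotopy F G⟩

instance SimplyConnectedSpace.pi {ι : Type*} {X : ι → Type*} [∀ i, TopologicalSpace (X i)]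
    [∀ i, SimplyConnectedSpace (X i)] : SimplyConnectedSpace (∀ i, X i) := by
  have hpc : PathConnectedSpace (∀ i, X i) :=
    { nonempty := ⟨fun i => Classical.arbitrary _⟩
      joined := fun x y => ⟨Path.pi fun i => PathConnectedSpace.somePath (x i) (y i)⟩ }
  refine simply_connected_iff_paths_homotopic'.2 ⟨hpc, fun {x y} p q => ?_⟩
  have F := fun i => (SimplyConnectedSpace.paths_homotopic (p.map (continuous_apply i))
    (q.map (continuous_apply i))).some
  exact ⟨Path.Homotopic.piHomotopy _ _ F⟩

/-! ### Gluing two simply connected open sets. -/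

/-- Two paths with the same end points inside a simply connected set are homotopic. -/
theorem IsSimplyConnected.paths_homotopic {X : Type*} [TopologicalSpace X] {S : Set X}
    (hS : IsSimplyConnected S) {x y : X} (p q : Path x y) (hp : ∀ t, p t ∈ S)
    (hq : ∀ t, q t ∈ S) : p.Homotopic q := by
  have := hS.simplyConnectedSpace
  have hx : x ∈ S := by simpa using hp 0
  have hy : y ∈ S := by simpa using hp 1
  let p' : Path (⟨x, hx⟩ : S) ⟨y, hy⟩ :=
    { toFun := fun t => ⟨p t, hp t⟩, continuous_toFun := by fun_prop,
      source' := by simp, target' := by simp }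
  let q' : Path (⟨x, hx⟩ : S) ⟨y, hy⟩ :=
    { toFun := fun t => ⟨q t, hq t⟩, continuous_toFun := by fun_prop,
      source' := by simp, target' := by simp }
  exact (SimplyConnectedSpace.paths_homotopic p' q').map ⟨Subtype.val, continuous_subtype_val⟩

/-- If a space is the union of two open simply connected subsets with path connected
intersection, it is simply connected. -/
theorem SimplyConnectedSpace.of_open_cover {X : Type*} [TopologicalSpace X] {U V : Set X}
    (hU : IsOpen U) (hV : IsOpen V) (hUV : U ∪ V = Set.univ) (sU : IsSimplyConnected U)
    (sV : IsSimplyConnected V) (hI : IsPathConnected (U ∩ V)) : SimplyConnectedSpace X := by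
  obtain ⟨x₀, h₀⟩ := hI.nonempty
  -- The path from the base point to `x` stays inside every one of the two sets that contains `x`;
  -- for `x` in both, this uses path connectedness of the intersection.
  have hc : ∀ x, ∃ c : Path x₀ x, (x ∈ U → ∀ t, c t ∈ U) ∧ (x ∈ V → ∀ t, c t ∈ V) := by
    intro x
    by_cases hxU : x ∈ U
    · by_cases hxV : x ∈ V
      · obtain ⟨c, h⟩ := hI.joinedIn x₀ h₀ x ⟨hxU, hxV⟩
        exact ⟨c, fun _ t => (h t).1, fun _ t => (h t).2⟩
      · obtain ⟨c, h⟩ := sU.isPathConnected.joinedIn x₀ h₀.1 x hxU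
        exact ⟨c, fun _ t => h t, fun h => absurd h hxV⟩
    · have hxV : x ∈ V := (hUV.symm ▸ Set.mem_univ x : x ∈ U ∪ V).resolve_left hxU
      obtain ⟨c, h⟩ := sV.isPathConnected.joinedIn x₀ h₀.2 x hxV
      exact ⟨c, fun h => absurd h hxU, fun _ t => h t⟩
  choose c hcU hcV using hc
  have trans_mem : ∀ {S : Set X} {x y z : X} (p : Path x y) (q : Path y z), (∀ t, p t ∈ S) →
      (∀ t, q t ∈ S) → ∀ t, p.trans q t ∈ S := by
    intro S x y z p q hp hq t
    have : p.trans q t ∈ Set.range (p.trans q) := ⟨t, rfl⟩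
    rw [Path.trans_range] at this
    rcases this with ⟨s, hs⟩ | ⟨s, hs⟩
    · exact hs ▸ hp s
    · exact hs ▸ hq s
  have small : ∀ {x y : X} (p : Path x y), ((∀ t, p t ∈ U) ∨ (∀ t, p t ∈ V)) →
      (Path.Homotopic.Quotient.mk (c x)).trans (.mk p) = .mk (c y) := by
    intro x y p hp
    rw [← Path.Homotopic.Quotient.mk_trans, Path.Homotopic.Quotient.eq]
    rcases hp with hp | hp
    · have hx : x ∈ U := by simpa using hp 0
      have hy : y ∈ U := by simpa using hp 1
      exact sU.paths_homotopic _ _ (trans_mem _ _ (hcU x hx) hp) (hcU y hy)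
    · have hx : x ∈ V := by simpa using hp 0
      have hy : y ∈ V := by simpa using hp 1
      exact sV.paths_homotopic _ _ (trans_mem _ _ (hcV x hx) hp) (hcV y hy)
  -- Subdivide `γ` into pieces lying in `U` or in `V` and apply `small` to each. Taking `y = x`, the
  -- relation [c x][γ] = [c x] then trivializes every loop.
  have main : ∀ {x y : X} (γ : Path x y),
      (Path.Homotopic.Quotient.mk (c x)).trans (.mk γ) = .mk (c y) := by
    intro x y γ
    obtain ⟨t, t_0, t_mono, ⟨n_max, h_max⟩, t_sub⟩ :=
      exists_monotone_Icc_subset_open_cover_unitInterval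
        (c := fun b : Bool => γ ⁻¹' (if b then U else V))
        (fun b => by cases b <;> simp [hU.preimage γ.continuous, hV.preimage γ.continuous])
        (fun s _ => by
          rcases (hUV.symm ▸ Set.mem_univ (γ s) : γ s ∈ U ∪ V) with h | h
          · exact Set.mem_iUnion.2 ⟨true, by simpa using h⟩
          · exact Set.mem_iUnion.2 ⟨false, by simpa using h⟩)
    have step : ∀ n, (Path.Homotopic.Quotient.mk (c (γ 0))).trans (.mk (γ.subpath 0 (t n))) =
        .mk (c (γ (t n))) := by
      intro n
      induction n with
      | zero =>
        rw [t_0]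
        simp
      | succ n ih =>
        have h1 : Path.Homotopic.Quotient.mk (γ.subpath 0 (t (n + 1))) =
            (Path.Homotopic.Quotient.mk (γ.subpath 0 (t n))).trans
              (.mk (γ.subpath (t n) (t (n + 1)))) := by
          rw [← Path.Homotopic.Quotient.mk_trans, Path.Homotopic.Quotient.eq]
          exact ⟨(Path.Homotopy.subpathTransSubpath γ _ _ _).symm⟩
        rw [h1, ← Path.Homotopic.Quotient.trans_assoc, ih]
        apply small
        have hr := Path.range_subpath_of_le γ _ _ (t_mono n.le_succ)
        obtain ⟨b, hb⟩ := t_sub n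
        have hmem : ∀ s, γ.subpath (t n) (t (n + 1)) s ∈ (if b then U else V) := by
          intro s
          have : γ.subpath (t n) (t (n + 1)) s ∈ Set.range (γ.subpath (t n) (t (n + 1))) :=
            ⟨s, rfl⟩
          rw [hr] at this
          obtain ⟨r, hr, hrs⟩ := this
          rw [← hrs]
          exact hb hr
        cases b
        · exact Or.inr (by simpa using hmem)
        · exact Or.inl (by simpa using hmem)
    have h1 := step n_max
    rw [h_max _ le_rfl, Path.subpath_zero_one, Path.Homotopic.Quotient.mk_cast] at h1
    have : ∀ {x' y' : X} (hx : x' = x) (hy : y' = y),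
        (Path.Homotopic.Quotient.mk (c x')).trans ((Path.Homotopic.Quotient.mk γ).cast hx hy) =
          .mk (c y') → (Path.Homotopic.Quotient.mk (c x)).trans (.mk γ) = .mk (c y) := by
      intro x' y' hx hy h
      subst hx hy
      simpa using h
    exact this _ _ h1
  refine simply_connected_iff_loops_nullhomotopic.2
    ⟨{ nonempty := ⟨x₀⟩, joined := fun x y => ⟨(c x).symm.trans (c y)⟩ }, fun x γ => ?_⟩
  rw [← Path.Homotopic.Quotient.eq]
  have h := congrArg (fun q => (Path.Homotopic.Quotient.mk (c x)).symm.trans q) (main γ)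
  simpa [← Path.Homotopic.Quotient.trans_assoc] using h

end

noncomputable section

open Topology ComplexConjugate

/-! ### The universal cover of the general linear group -/

/-- The universal cover of `GL(ι, ℂ)`: invertible matrices with a logarithm of the determinant. -/
def DetCover (ι : Type*) [Fintype ι] [DecidableEq ι] : Type _ :=
  {p : Matrix ι ι ℂ × ℂ // p.1.det = Complex.exp p.2}

namespace DetCover

variable {ι : Type*} [Fintype ι] [DecidableEq ι]

instance : TopologicalSpace (DetCover ι) :=
  inferInstanceAs (TopologicalSpace {p : Matrix ι ι ℂ × ℂ // p.1.det = Complex.exp p.2})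

/-- The underlying matrix. -/
def mat (y : DetCover ι) : Matrix ι ι ℂ := y.1.1

/-- The chosen logarithm of the determinant. -/
def logDet (y : DetCover ι) : ℂ := y.1.2

theorem det_mat (y : DetCover ι) : y.mat.det = Complex.exp y.logDet := y.2

theorem isUnit_det (y : DetCover ι) : IsUnit y.mat.det := by
  rw [det_mat]; exact isUnit_iff_ne_zero.2 (Complex.exp_ne_zero _)

/-- Constructor from a matrix and a logarithm of its determinant. -/
def mk (A : Matrix ι ι ℂ) (w : ℂ) (h : A.det = Complex.exp w) : DetCover ι := ⟨(A, w), h⟩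

@[simp] theorem mat_mk (A : Matrix ι ι ℂ) (w : ℂ) (h) : (mk A w h).mat = A := rfl
@[simp] theorem logDet_mk (A : Matrix ι ι ℂ) (w : ℂ) (h) : (mk A w h).logDet = w := rfl

@[ext] theorem ext {x y : DetCover ι} (h : x.mat = y.mat) (h' : x.logDet = y.logDet) : x = y :=
  Subtype.ext (Prod.ext h h')

@[fun_prop] theorem continuous_mat : Continuous (mat : DetCover ι → Matrix ι ι ℂ) :=
  continuous_fst.comp continuous_subtype_val

@[fun_prop] theorem continuous_logDet : Continuous (logDet : DetCover ι → ℂ) :=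
  continuous_snd.comp continuous_subtype_val

theorem continuous_of {X : Type*} [TopologicalSpace X] {f : X → DetCover ι}
    (h : Continuous fun x => (f x).mat) (h' : Continuous fun x => (f x).logDet) : Continuous f :=
  Continuous.subtype_mk (h.prodMk h') fun x => (f x).2

instance : Group (DetCover ι) where
  mul x y := mk (x.mat * y.mat) (x.logDet + y.logDet) (by
    rw [Matrix.det_mul, det_mat, det_mat, Complex.exp_add])
  one := mk 1 0 (by simp)
  inv x := mk x.mat⁻¹ (-x.logDet) (by
    rw [Matrix.det_nonsing_inv, det_mat, Ring.inverse_eq_inv', Complex.exp_neg])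
  mul_assoc x y z := ext (Matrix.mul_assoc _ _ _) (add_assoc _ _ _)
  one_mul x := ext (Matrix.one_mul _) (zero_add _)
  mul_one x := ext (Matrix.mul_one _) (add_zero _)
  inv_mul_cancel x := ext (Matrix.nonsing_inv_mul _ x.isUnit_det) (neg_add_cancel _)

@[simp] theorem mat_mul (x y : DetCover ι) : (x * y).mat = x.mat * y.mat := rfl
@[simp] theorem logDet_mul (x y : DetCover ι) : (x * y).logDet = x.logDet + y.logDet := rfl
@[simp] theorem mat_one : (1 : DetCover ι).mat = 1 := rfl
@[simp] theorem logDet_one : (1 : DetCover ι).logDet = 0 := rfl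
@[simp] theorem mat_inv (x : DetCover ι) : (x⁻¹).mat = x.mat⁻¹ := rfl
@[simp] theorem logDet_inv (x : DetCover ι) : (x⁻¹).logDet = -x.logDet := rfl

theorem mat_mul_mat_inv (x : DetCover ι) : x.mat * (x⁻¹).mat = 1 :=
  congrArg mat (mul_inv_cancel x)

theorem mat_inv_mul_mat (x : DetCover ι) : (x⁻¹).mat * x.mat = 1 :=
  congrArg mat (inv_mul_cancel x)

theorem _root_.Continuous.matrix_inv_of_det_ne_zero {X : Type*} [TopologicalSpace X]
    {f : X → Matrix ι ι ℂ} (hf : Continuous f) (h : ∀ x, (f x).det ≠ 0) :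
    Continuous fun x => (f x)⁻¹ := by
  simp only [Matrix.inv_def, Ring.inverse_eq_inv']
  exact (hf.matrix_det.inv₀ h).smul hf.matrix_adjugate

instance : IsTopologicalGroup (DetCover ι) where
  continuous_mul := continuous_of
    ((continuous_mat.comp continuous_fst).matrix_mul (continuous_mat.comp continuous_snd))
    ((continuous_logDet.comp continuous_fst).add (continuous_logDet.comp continuous_snd))
  continuous_inv := continuous_of
    (continuous_mat.matrix_inv_of_det_ne_zero fun x => x.isUnit_det.ne_zero)
    continuous_logDet.neg

/-- `DetCover` only depends on the cardinality of the index type. -/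
def reindex {κ : Type*} [Fintype κ] [DecidableEq κ] (e : ι ≃ κ) : DetCover ι ≃ₜ DetCover κ where
  toFun x := mk (x.mat.submatrix e.symm e.symm) x.logDet (by
    rw [Matrix.det_submatrix_equiv_self, det_mat])
  invFun x := mk (x.mat.submatrix e e) x.logDet (by
    rw [Matrix.det_submatrix_equiv_self, det_mat])
  left_inv x := ext (by simp) rfl
  right_inv x := ext (by simp) rfl
  continuous_toFun := continuous_of (continuous_mat.matrix_submatrix _ _) continuous_logDet
  continuous_invFun := continuous_of (continuous_mat.matrix_submatrix _ _) continuous_logDet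

/-- The single matrix entry is the exponential of the logarithm, so the space is a copy of ℂ. -/
theorem simplyConnectedSpace_of_unique [Unique ι] : SimplyConnectedSpace (DetCover ι) := by
  refine .of_retract (Y := ℂ) logDet
    (fun w => mk (Matrix.of fun _ _ => Complex.exp w) w (by simp [Matrix.det_unique]))
    continuous_logDet (continuous_of ?_ continuous_id) fun x => ext ?_ rfl
  · exact continuous_matrix fun _ _ => Complex.continuous_exp
  · ext i j
    obtain rfl := Unique.eq_default i
    obtain rfl := Unique.eq_default j
    simp [← det_mat, Matrix.det_unique]

/-! #### The first column -/

/-- The Euclidean norm. -/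
def colNorm (v : ℂ × (ι → ℂ)) : ℝ :=
  Real.sqrt (Complex.normSq v.1 + ∑ i, Complex.normSq (v.2 i))

@[fun_prop] theorem continuous_colNorm : Continuous (colNorm : ℂ × (ι → ℂ) → ℝ) := by
  unfold colNorm
  refine Real.continuous_sqrt.comp (Continuous.add ?_ ?_)
  · exact Complex.continuous_normSq.comp continuous_fst
  · exact continuous_finsetSum _ fun i _ => Complex.continuous_normSq.comp
      ((continuous_apply i).comp continuous_snd)

theorem colNorm_sq (v : ℂ × (ι → ℂ)) :
    colNorm v ^ 2 = Complex.normSq v.1 + ∑ i, Complex.normSq (v.2 i) :=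
  Real.sq_sqrt (add_nonneg (Complex.normSq_nonneg _)
    (Finset.sum_nonneg fun _ _ => Complex.normSq_nonneg _))

theorem colNorm_nonneg (v : ℂ × (ι → ℂ)) : 0 ≤ colNorm v := Real.sqrt_nonneg _

/-- The complement of the closed ray through `(-1, 0)`. -/
def slitSpace (ι : Type*) [Fintype ι] : Set (ℂ × (ι → ℂ)) :=
  {v | 0 < v.1.re + colNorm v}

/-- The Euclidean norm equals minus the real part of the first coordinate only when every other real
coordinate vanishes and that real part is nonpositive. In particular the origin is excluded. -/
theorem mem_slitSpace_iff (v : ℂ × (ι → ℂ)) :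
    v ∈ slitSpace ι ↔ 0 < v.1.re ∨ v.1.im ≠ 0 ∨ v.2 ≠ 0 := by
  have hs : 0 ≤ ∑ i, Complex.normSq (v.2 i) :=
    Finset.sum_nonneg fun _ _ => Complex.normSq_nonneg _
  have hsq := colNorm_sq v
  have hn := colNorm_nonneg v
  rw [Complex.normSq_apply] at hsq
  change 0 < v.1.re + colNorm v ↔ _
  constructor
  · intro h
    by_contra! hc
    obtain ⟨h1, h2, h3⟩ := hc
    simp only [h2, h3, Pi.zero_apply, map_zero, Finset.sum_const_zero] at hsq
    nlinarith
  · intro h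
    by_contra! hc
    have h1 : v.1.re ≤ 0 := by linarith
    have h2 : colNorm v ^ 2 ≤ v.1.re ^ 2 := by nlinarith
    have him : v.1.im * v.1.im = 0 := by nlinarith [mul_self_nonneg v.1.im]
    have hsum : ∑ i, Complex.normSq (v.2 i) = 0 := by nlinarith [mul_self_nonneg v.1.im]
    rcases h with h | h | h
    · linarith
    · exact h (mul_self_eq_zero.1 him)
    · apply h
      funext i
      rw [Finset.sum_eq_zero_iff_of_nonneg fun _ _ => Complex.normSq_nonneg _] at hsum
      exact Complex.normSq_eq_zero.1 (hsum i (Finset.mem_univ i))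

theorem isOpen_slitSpace : IsOpen (slitSpace ι) :=
  isOpen_lt continuous_const ((Complex.continuous_re.comp continuous_fst).add continuous_colNorm)

theorem contractibleSpace_slitSpace : ContractibleSpace (slitSpace ι) := by
  refine StarConvex.contractibleSpace (x := ((1 : ℂ), (0 : ι → ℂ))) ?_ ⟨(1, 0), ?_⟩
  · intro v hv a b ha hb hab
    rw [mem_slitSpace_iff] at hv ⊢
    rcases hb.eq_or_lt with rfl | hb
    · left; simp_all
    · rcases hv with hv | hv | hv
      · left
        have : 0 < b * v.1.re := mul_pos hb hv
        simp; linarith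
      · right; left
        simp [hb.ne', hv]
      · right; right
        simp [hb.ne', hv]
  · rw [mem_slitSpace_iff]; simp

/-- What is removed is the real line spanned by `(1, 0)`, the kernel of `F`; its real codimension is
1 + 2|ι|, which exceeds 1. -/
theorem isPathConnected_slitSpace_inter [Nonempty ι] :
    IsPathConnected (slitSpace ι ∩ {v | -v ∈ slitSpace ι}) := by
  let F : ℂ × (ι → ℂ) →ₗ[ℝ] ℝ × (ι → ℂ) :=
    (Complex.imLm.comp (LinearMap.fst ℝ _ _)).prod (LinearMap.snd ℝ _ _)
  have hF : Function.Surjective F := by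
    rintro ⟨x, b⟩
    exact ⟨(⟨0, x⟩, b), by simp [F]⟩
  have hE : slitSpace ι ∩ {v | -v ∈ slitSpace ι} = ((LinearMap.ker F : Submodule ℝ _) : Set _)ᶜ := by
    ext v
    simp only [Set.mem_inter_iff, Set.mem_ofPred_eq, mem_slitSpace_iff, Set.mem_compl_iff,
      SetLike.mem_coe, LinearMap.mem_ker]
    have : F v = 0 ↔ v.1.im = 0 ∧ v.2 = 0 := by simp [F, Prod.ext_iff]
    rw [this]
    simp only [Prod.fst_neg, Prod.snd_neg, Complex.neg_re, Complex.neg_im, neg_ne_zero]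
    constructor
    · rintro ⟨h1, h2⟩ ⟨h3, h4⟩
      simp only [h3, h4, ne_eq, not_true_eq_false, or_false] at h1 h2
      linarith
    · intro h
      have : v.1.im ≠ 0 ∨ v.2 ≠ 0 := by tauto
      exact ⟨Or.inr this, Or.inr this⟩
  rw [hE]
  apply isPathConnected_compl_of_one_lt_codim
  have e := F.quotKerEquivOfSurjective hF
  rw [e.rank_eq, ← Module.finrank_eq_rank]
  have : 0 < Fintype.card ι := Fintype.card_pos
  have h2 : 1 < Module.finrank ℝ (ℝ × (ι → ℂ)) := by
    rw [Module.finrank_prod, Module.finrank_pi_fintype]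
    simp only [Module.finrank_self, Complex.finrank_real_complex, Finset.sum_const,
      Finset.card_univ, smul_eq_mul]
    omega
  exact_mod_cast h2

/-- An invertible matrix with prescribed first column, depending continuously on this column. -/
def colMatrix (v : ℂ × (ι → ℂ)) : Matrix (Unit ⊕ ι) (Unit ⊕ ι) ℂ :=
  Matrix.fromBlocks (Matrix.of fun _ _ => v.1) (Matrix.of fun _ i => -conj (v.2 i))
    (Matrix.of fun i _ => v.2 i)
    ((conj v.1 + colNorm v) • (1 : Matrix ι ι ℂ))

@[fun_prop] theorem continuous_colMatrix :
    Continuous (colMatrix : ℂ × (ι → ℂ) → Matrix (Unit ⊕ ι) (Unit ⊕ ι) ℂ) := by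
  unfold colMatrix
  have hs : ∀ i, Continuous fun v : ℂ × (ι → ℂ) => v.2 i := fun i =>
    (continuous_apply i).comp continuous_snd
  have hf : Continuous fun v : ℂ × (ι → ℂ) => v.1 := continuous_fst
  have hD : Continuous fun v : ℂ × (ι → ℂ) => conj v.1 + (colNorm v : ℂ) :=
    (Complex.continuous_conj.comp hf).add (Complex.continuous_ofReal.comp continuous_colNorm)
  exact Continuous.matrix_fromBlocks (continuous_matrix fun _ _ => hf)
    (continuous_matrix fun _ i => (Complex.continuous_conj.comp (hs i)).neg)
    (continuous_matrix fun i _ => hs i) (hD.smul continuous_const)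

/-- The Schur complement of the scalar lower right block is `v.1` plus the squared norm of `v.2`
over that scalar. The summand `colNorm v` in the scalar keeps it in the open right half plane on the
slit space, so it is invertible there and has a principal logarithm. -/
theorem det_colMatrix {v : ℂ × (ι → ℂ)} (h : conj v.1 + (colNorm v : ℂ) ≠ 0) :
    (colMatrix v).det = (conj v.1 + colNorm v) ^ Fintype.card ι *
      (colNorm v * (v.1 + colNorm v) / (conj v.1 + colNorm v)) := by
  let _ : Invertible ((conj v.1 + (colNorm v : ℂ)) • (1 : Matrix ι ι ℂ)) :=
    ⟨(conj v.1 + (colNorm v : ℂ))⁻¹ • 1, by simp [smul_smul, h], by simp [smul_smul, h]⟩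
  have hinv : ⅟((conj v.1 + (colNorm v : ℂ)) • (1 : Matrix ι ι ℂ)) =
    (conj v.1 + (colNorm v : ℂ))⁻¹ • 1 := rfl
  have hsq : (colNorm v : ℂ) ^ 2 = v.1 * conj v.1 + ∑ i, v.2 i * conj (v.2 i) := by
    rw [← Complex.ofReal_pow, colNorm_sq]
    simp [Complex.mul_conj]
  rw [colMatrix, Matrix.det_fromBlocks₂₂, hinv, Matrix.det_smul, Matrix.det_one, mul_one]
  congr 1
  rw [Matrix.det_unique]
  simp only [Matrix.sub_apply, Matrix.of_apply, Matrix.mul_smul, Matrix.mul_one, Matrix.smul_mul,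
    Matrix.smul_apply, Matrix.mul_apply, smul_eq_mul]
  have : ∑ x, -conj (v.2 x) * v.2 x = -∑ i, v.2 i * conj (v.2 i) := by
    rw [← Finset.sum_neg_distrib]; exact Finset.sum_congr rfl fun _ _ => by ring
  rw [this, eq_div_iff h]
  field_simp
  linear_combination -hsq

/-- A continuous logarithm of the determinant of `colMatrix`. -/
def colLog (v : ℂ × (ι → ℂ)) : ℂ :=
  Fintype.card ι * Complex.log (conj v.1 + colNorm v) + (Complex.log (colNorm v) +
    Complex.log (v.1 + colNorm v) - Complex.log (conj v.1 + colNorm v))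

theorem re_pos_of_mem {v : ℂ × (ι → ℂ)} (hv : v ∈ slitSpace ι) :
    0 < (conj v.1 + (colNorm v : ℂ)).re ∧ 0 < (v.1 + (colNorm v : ℂ)).re ∧ 0 < colNorm v := by
  have h1 : 0 < v.1.re + colNorm v := hv
  refine ⟨by simpa using h1, by simpa using h1, (colNorm_nonneg v).lt_of_ne fun h => ?_⟩
  have hs : 0 ≤ ∑ i, Complex.normSq (v.2 i) :=
    Finset.sum_nonneg fun _ _ => Complex.normSq_nonneg _
  have h2 := colNorm_sq v
  rw [← h] at h1 h2
  rw [Complex.normSq_apply] at h2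
  nlinarith [mul_self_nonneg v.1.im]

theorem exp_colLog {v : ℂ × (ι → ℂ)} (hv : v ∈ slitSpace ι) :
    (colMatrix v).det = Complex.exp (colLog v) := by
  obtain ⟨h1, h2, h3⟩ := re_pos_of_mem hv
  have h1' : conj v.1 + (colNorm v : ℂ) ≠ 0 := fun h => by simp [h] at h1
  have h2' : v.1 + (colNorm v : ℂ) ≠ 0 := fun h => by simp [h] at h2
  have h3' : (colNorm v : ℂ) ≠ 0 := by exact_mod_cast h3.ne'
  rw [det_colMatrix h1', colLog, Complex.exp_add, Complex.exp_sub, Complex.exp_add,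
    Complex.exp_nat_mul, Complex.exp_log h1', Complex.exp_log h2', Complex.exp_log h3']

theorem continuousOn_colLog : ContinuousOn (colLog : ℂ × (ι → ℂ) → ℂ) (slitSpace ι) := by
  intro v hv
  obtain ⟨h1, h2, h3⟩ := re_pos_of_mem hv
  have c0 : ContinuousAt (fun v : ℂ × (ι → ℂ) => (colNorm v : ℂ)) v :=
    (Complex.continuous_ofReal.comp continuous_colNorm).continuousAt
  have c1 : ContinuousAt (fun v : ℂ × (ι → ℂ) => Complex.log (conj v.1 + colNorm v)) v :=
    ((Complex.continuous_conj.comp continuous_fst).continuousAt.add c0).clog (Or.inl h1)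
  have c2 : ContinuousAt (fun v : ℂ × (ι → ℂ) => Complex.log (v.1 + colNorm v)) v :=
    (continuous_fst.continuousAt.add c0).clog (Or.inl h2)
  have c3 : ContinuousAt (fun v : ℂ × (ι → ℂ) => Complex.log (colNorm v)) v :=
    c0.clog (Or.inl (by simpa using h3))
  exact ((continuousAt_const.mul c1).add ((c3.add c2).sub c1)).continuousWithinAt

theorem continuous_colLog : Continuous fun v : slitSpace ι => colLog v.1 :=
  continuousOn_iff_continuous_domRestrict.1 continuousOn_colLog

/-! ### The first column map and the induction on the size of the matrix. -/

/-- The first column of a matrix. -/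
def firstCol (y : DetCover (Unit ⊕ ι)) : ℂ × (ι → ℂ) :=
  (y.mat (.inl ()) (.inl ()), fun i => y.mat (.inr i) (.inl ()))

@[fun_prop] theorem continuous_firstCol :
    Continuous (firstCol : DetCover (Unit ⊕ ι) → ℂ × (ι → ℂ)) :=
  (continuous_mat.matrix_elem _ _).prodMk (continuous_pi fun _ => continuous_mat.matrix_elem _ _)

theorem firstCol_ne_zero (y : DetCover (Unit ⊕ ι)) : firstCol y ≠ 0 := by
  intro h
  have h1 : ∀ i, y.mat i (.inl ()) = 0 := by
    rintro (i | i)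
    · exact congrArg Prod.fst h
    · exact congrFun (congrArg Prod.snd h) i
  exact y.isUnit_det.ne_zero (Matrix.det_eq_zero_of_column_eq_zero _ h1)

/-- The trivialization of the first column map over the slit space. -/
def assemble (v : slitSpace ι) (ρ : ι → ℂ) (y : DetCover ι) : DetCover (Unit ⊕ ι) :=
  mk (colMatrix v.1 * Matrix.fromBlocks 1 (Matrix.of fun _ i => ρ i) 0 y.mat)
    (colLog v.1 + y.logDet) (by
      rw [Matrix.det_mul, exp_colLog v.2, Matrix.det_fromBlocks_zero₂₁, Matrix.det_one, one_mul,
        det_mat, Complex.exp_add])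

theorem continuous_assemble :
    Continuous fun p : slitSpace ι × (ι → ℂ) × DetCover ι => assemble p.1 p.2.1 p.2.2 := by
  refine continuous_of ?_ ?_
  · refine Continuous.matrix_mul (continuous_colMatrix.comp
      (continuous_subtype_val.comp continuous_fst)) (Continuous.matrix_fromBlocks
        continuous_const (continuous_matrix fun _ i => ?_) continuous_const ?_)
    · exact (continuous_apply i).comp (continuous_fst.comp continuous_snd)
    · exact continuous_mat.comp (continuous_snd.comp continuous_snd)
  · exact (continuous_colLog.comp continuous_fst).add
      (continuous_logDet.comp (continuous_snd.comp continuous_snd))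

theorem firstCol_assemble (v : slitSpace ι) (ρ : ι → ℂ) (y : DetCover ι) :
    firstCol (assemble v ρ y) = v.1 := by
  refine Prod.ext ?_ (funext fun i => ?_)
  · simp [firstCol, assemble, colMatrix, Matrix.fromBlocks_multiply]
  · simp [firstCol, assemble, colMatrix, Matrix.fromBlocks_multiply]

/-- Both matrices have the same first column, so the quotient fixes the first basis vector. -/
theorem colMatrix_inv_mul_mat {y : DetCover (Unit ⊕ ι)} (hy : firstCol y ∈ slitSpace ι) :
    (colMatrix (firstCol y))⁻¹ * y.mat =
      Matrix.fromBlocks 1 ((colMatrix (firstCol y))⁻¹ * y.mat).toBlocks₁₂ 0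
        ((colMatrix (firstCol y))⁻¹ * y.mat).toBlocks₂₂ := by
  have hu : IsUnit (colMatrix (firstCol y)).det := by
    rw [exp_colLog hy]; exact isUnit_iff_ne_zero.2 (Complex.exp_ne_zero _)
  have hcol : ∀ i, ((colMatrix (firstCol y))⁻¹ * y.mat) i (.inl ()) =
      (1 : Matrix (Unit ⊕ ι) (Unit ⊕ ι) ℂ) i (.inl ()) := by
    intro i
    rw [← Matrix.nonsing_inv_mul _ hu, Matrix.mul_apply, Matrix.mul_apply]
    refine Finset.sum_congr rfl fun k _ => ?_
    congr 1
    rcases k with k | k <;> rfl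
  conv_lhs => rw [← Matrix.fromBlocks_toBlocks ((colMatrix (firstCol y))⁻¹ * y.mat)]
  congr 1
  · ext i j; simpa [Matrix.toBlocks₁₁, Matrix.one_apply] using hcol (.inl i)
  · ext i j; simpa [Matrix.toBlocks₂₁, Matrix.one_apply] using hcol (.inr i)

/-- The inverse of `assemble`. -/
def disassemble (y : {y : DetCover (Unit ⊕ ι) // firstCol y ∈ slitSpace ι}) :
    slitSpace ι × (ι → ℂ) × DetCover ι :=
  (⟨firstCol y.1, y.2⟩, fun i => ((colMatrix (firstCol y.1))⁻¹ * y.1.mat) (.inl ()) (.inr i),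
    mk ((colMatrix (firstCol y.1))⁻¹ * y.1.mat).toBlocks₂₂ (y.1.logDet - colLog (firstCol y.1)) (by
      have h := congrArg Matrix.det (colMatrix_inv_mul_mat y.2)
      rw [Matrix.det_fromBlocks_zero₂₁, Matrix.det_one, one_mul] at h
      rw [← h, Matrix.det_mul, Matrix.det_nonsing_inv, exp_colLog y.2, det_mat,
        Ring.inverse_eq_inv', Complex.exp_sub]
      field_simp))

theorem continuous_disassemble :
    Continuous (disassemble (ι := ι)) := by
  have hcol : Continuous fun y : {y : DetCover (Unit ⊕ ι) // firstCol y ∈ slitSpace ι} =>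
      firstCol y.1 := continuous_firstCol.comp continuous_subtype_val
  have hm : Continuous fun y : {y : DetCover (Unit ⊕ ι) // firstCol y ∈ slitSpace ι} =>
      (colMatrix (firstCol y.1))⁻¹ * y.1.mat := by
    refine Continuous.matrix_mul (Continuous.matrix_inv_of_det_ne_zero
      (continuous_colMatrix.comp hcol) fun y => ?_) (continuous_mat.comp continuous_subtype_val)
    rw [exp_colLog y.2]; exact Complex.exp_ne_zero _
  refine (hcol.subtype_mk _).prodMk ((continuous_pi fun i => hm.matrix_elem _ _).prodMk ?_)
  refine continuous_of (continuous_matrix fun i j => hm.matrix_elem _ _) ?_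
  have hlog : Continuous fun y : {y : DetCover (Unit ⊕ ι) // firstCol y ∈ slitSpace ι} =>
      colLog (firstCol y.1) :=
    Continuous.comp (g := fun v : slitSpace ι => colLog v.1)
      (f := fun y : {y : DetCover (Unit ⊕ ι) // firstCol y ∈ slitSpace ι} =>
        (⟨firstCol y.1, y.2⟩ : slitSpace ι)) continuous_colLog (hcol.subtype_mk _)
  exact (continuous_logDet.comp continuous_subtype_val).sub hlog

theorem assemble_disassemble (y : {y : DetCover (Unit ⊕ ι) // firstCol y ∈ slitSpace ι}) :
    assemble (disassemble y).1 (disassemble y).2.1 (disassemble y).2.2 = y.1 := by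
  have hu : IsUnit (colMatrix (firstCol y.1)).det := by
    rw [exp_colLog y.2]; exact isUnit_iff_ne_zero.2 (Complex.exp_ne_zero _)
  refine ext ?_ ?_
  · have h := colMatrix_inv_mul_mat y.2
    have h2 : (assemble (disassemble y).1 (disassemble y).2.1 (disassemble y).2.2).mat =
        colMatrix (firstCol y.1) * ((colMatrix (firstCol y.1))⁻¹ * y.1.mat) := by
      rw [h]; rfl
    rw [h2, Matrix.mul_nonsing_inv_cancel_left _ _ hu]
  · simp [assemble, disassemble]

/-- Over the slit space the first column map is a product with fibre `(ι → ℂ) × DetCover ι`, and the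
base is contractible. A one-sided inverse suffices, since only a retract is needed. -/
theorem isSimplyConnected_preimage_slitSpace [SimplyConnectedSpace (DetCover ι)] :
    IsSimplyConnected {y : DetCover (Unit ⊕ ι) | firstCol y ∈ slitSpace ι} := by
  have := contractibleSpace_slitSpace (ι := ι)
  have hmem : ∀ p : slitSpace ι × (ι → ℂ) × DetCover ι,
      assemble p.1 p.2.1 p.2.2 ∈ {y : DetCover (Unit ⊕ ι) | firstCol y ∈ slitSpace ι} := by
    intro p
    rw [Set.mem_ofPred_eq, firstCol_assemble]
    exact p.1.2
  exact SimplyConnectedSpace.of_retract (Y := slitSpace ι × (ι → ℂ) × DetCover ι)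
    (fun y => disassemble ⟨y.1, y.2⟩) (fun p => ⟨assemble p.1 p.2.1 p.2.2, hmem p⟩)
    (continuous_disassemble.comp (continuous_subtype_val.subtype_mk fun y => y.2))
    (continuous_assemble.subtype_mk hmem) fun y => Subtype.ext (assemble_disassemble ⟨y.1, y.2⟩)

/-- The element with matrix `-1`. -/
def negOne (κ : Type*) [Fintype κ] [DecidableEq κ] : DetCover κ :=
  mk (-1) (Fintype.card κ * (Real.pi * Complex.I)) (by
    rw [Matrix.det_neg, Matrix.det_one, mul_one, Complex.exp_nat_mul, Complex.exp_pi_mul_I])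

theorem firstCol_negOne_mul (y : DetCover (Unit ⊕ ι)) :
    firstCol (negOne _ * y) = -firstCol y := by
  refine Prod.ext ?_ (funext fun i => ?_) <;> simp [firstCol, negOne]

/-- The first column takes values in the complement of the origin, which is covered by the slit
space and its negative; the preimages of these two sets are glued. -/
theorem simplyConnectedSpace_sum [Nonempty ι] [SimplyConnectedSpace (DetCover ι)] :
    SimplyConnectedSpace (DetCover (Unit ⊕ ι)) := by
  have hU := isSimplyConnected_preimage_slitSpace (ι := ι)
  -- Left translation by the element with matrix `-1` exchanges the two preimages.
  have hV : IsSimplyConnected {y : DetCover (Unit ⊕ ι) | -firstCol y ∈ slitSpace ι} := by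
    have := (Homeomorph.mulLeft (negOne (Unit ⊕ ι))).isSimplyConnected_preimage.2 hU
    convert this using 1
    ext y
    simp [firstCol_negOne_mul]
  refine .of_open_cover (U := {y : DetCover (Unit ⊕ ι) | firstCol y ∈ slitSpace ι})
    (V := {y : DetCover (Unit ⊕ ι) | -firstCol y ∈ slitSpace ι})
    (isOpen_slitSpace.preimage continuous_firstCol)
    (isOpen_slitSpace.preimage continuous_firstCol.neg) ?_ hU hV ?_
  · refine Set.eq_univ_of_forall fun y => ?_
    rw [Set.mem_union, Set.mem_ofPred_eq, Set.mem_ofPred_eq, mem_slitSpace_iff, mem_slitSpace_iff]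
    by_contra! hc
    obtain ⟨⟨h1, h2, h3⟩, h4, -, -⟩ := hc
    refine firstCol_ne_zero y (Prod.ext (Complex.ext ?_ h2) h3)
    simp only [Prod.fst_neg, Complex.neg_re] at h4
    exact le_antisymm h1 (by simpa using h4)
  · have := isPathConnected_iff_pathConnectedSpace.1 (isPathConnected_slitSpace_inter (ι := ι))
    let T : Set (ℂ × (ι → ℂ)) := slitSpace ι ∩ {v | -v ∈ slitSpace ι}
    let g : T × (ι → ℂ) × DetCover ι → DetCover (Unit ⊕ ι) :=
      fun p => assemble ⟨p.1.1, p.1.2.1⟩ p.2.1 p.2.2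
    have hfst : Continuous fun p : T × (ι → ℂ) × DetCover ι => (⟨p.1.1, p.1.2.1⟩ : slitSpace ι) :=
      (continuous_subtype_val.comp continuous_fst).subtype_mk fun p => p.1.2.1
    have hg : Continuous g :=
      Continuous.comp (g := fun p : slitSpace ι × (ι → ℂ) × DetCover ι => assemble p.1 p.2.1 p.2.2)
        (f := fun p : T × (ι → ℂ) × DetCover ι => ((⟨p.1.1, p.1.2.1⟩ : slitSpace ι), p.2))
        continuous_assemble (hfst.prodMk continuous_snd)
    convert isPathConnected_range hg
    ext y
    constructor
    · rintro ⟨h1, h2⟩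
      exact ⟨(⟨firstCol y, h1, h2⟩, (disassemble ⟨y, h1⟩).2), assemble_disassemble ⟨y, h1⟩⟩
    · rintro ⟨p, rfl⟩
      have := firstCol_assemble ⟨p.1.1, p.1.2.1⟩ p.2.1 p.2.2
      rw [Set.mem_inter_iff, Set.mem_ofPred_eq, Set.mem_ofPred_eq, this]
      exact p.1.2

/-- The universal cover of `GL(n, ℂ)` is simply connected for `n ≥ 1`. -/
theorem simplyConnectedSpace_fin : ∀ n : ℕ, n ≠ 0 → SimplyConnectedSpace (DetCover (Fin n))
  | 0, h => absurd rfl h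
  | 1, _ => simplyConnectedSpace_of_unique
  | n + 2, _ => by
    have := simplyConnectedSpace_fin (n + 1) (Nat.succ_ne_zero n)
    have := simplyConnectedSpace_sum (ι := Fin (n + 1))
    exact .of_homeomorph (reindex ((finSuccEquiv (n + 1)).trans
      ((Equiv.optionEquivSumPUnit _).trans (Equiv.sumComm _ _))))

end DetCover

end

noncomputable section

open Topology unitInterval

/-! ### The fundamental group of a homogeneous space -/

section Homogeneous

variable {X O : Type*} [Group X] [TopologicalSpace X] [IsTopologicalGroup X] [TopologicalSpace O]
  [MulAction X O] [ContinuousConstSMul X O]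

/-- Existence of a continuous local section of the orbit map through `o`. -/
def HasLocalSection (X : Type*) {O : Type*} [TopologicalSpace X] [TopologicalSpace O] [SMul X O]
    (o : O) : Prop :=
  ∃ U ∈ 𝓝 o, ∃ s : O → X, ContinuousOn s U ∧ ∀ y ∈ U, s y • o = y

theorem HasLocalSection.exists_section [MulAction.IsPretransitive X O] {o : O}
    (h : HasLocalSection X o) (x : X) : ∃ U : Set O, IsOpen U ∧ x • o ∈ U ∧
      ∃ s : O → X, ContinuousOn s U ∧ s (x • o) = x ∧ ∀ y, s y • o = y := by
  classical
  obtain ⟨U, hU, s, hs, hsU⟩ := h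
  choose g hg using fun y : O => MulAction.exists_smul_eq X o y
  -- Extending the section to all of `O` by arbitrary choices, with no continuity off `U`, makes the
  -- section identity hold everywhere.
  let s' : O → X := fun y => if y ∈ U then s y else g y
  have hs' : ContinuousOn s' U := hs.congr fun y hy => if_pos hy
  have hso : ∀ y, s' y • o = y := by
    intro y
    by_cases hy : y ∈ U
    · simp only [s', if_pos hy, hsU y hy]
    · simp only [s', if_neg hy, hg]
  have hso1 : (s' o)⁻¹ • o = o := by rw [inv_smul_eq_iff, hso]
  have hV : (fun y => x⁻¹ • y) ⁻¹' interior U ⊆ (fun y => x⁻¹ • y) ⁻¹' U :=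
    Set.preimage_mono interior_subset
  refine ⟨(fun y => x⁻¹ • y) ⁻¹' interior U, isOpen_interior.preimage (continuous_const_smul _),
    -- The section is transported to `x • o` by left translation; the right factor `(s' o)⁻¹` fixes
    -- `o` and normalizes the value there to `x`.
    by simpa using mem_interior_iff_mem_nhds.2 hU, fun y => x * s' (x⁻¹ • y) * (s' o)⁻¹,
    ?_, by simp, fun y => by rw [mul_smul, hso1, mul_smul, hso, smul_inv_smul]⟩
  refine ContinuousOn.mul (ContinuousOn.mul continuousOn_const ?_) continuousOn_const
  exact hs'.comp (continuous_const_smul _).continuousOn hV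

theorem HasLocalSection.isOpenQuotientMap [MulAction.IsPretransitive X O] {o : O}
    (h : HasLocalSection X o) (hc : Continuous fun x : X => x • o) :
    IsOpenQuotientMap fun x : X => x • o where
  surjective := MulAction.surjective_smul X o
  continuous := hc
  isOpenMap := by
    refine IsOpenMap.of_sections fun x => ?_
    obtain ⟨U, hU, hx, s, hs, hsx, hso⟩ := h.exists_section x
    exact ⟨s, hs.continuousAt (hU.mem_nhds hx), hsx, hso⟩

/-- Path lifting along an orbit map with local sections. -/
theorem HasLocalSection.exists_path_lift [MulAction.IsPretransitive X O] {o : O}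
    (h : HasLocalSection X o) (γ : C(I, O)) (x₀ : X) (hγ : x₀ • o = γ 0) :
    ∃ Γ : C(I, X), (∀ t, Γ t • o = γ t) ∧ Γ 0 = x₀ := by
  choose U hU hmem s hs _ hso using h.exists_section
  obtain ⟨t, t_0, t_mono, ⟨n_max, h_max⟩, t_sub⟩ :=
    exists_monotone_Icc_subset_open_cover_unitInterval
    (fun x ↦ (hU x).preimage γ.continuous) fun t _ ↦ by
      obtain ⟨x, hx⟩ := MulAction.exists_smul_eq X o (γ t)
      refine Set.mem_iUnion.2 ⟨x, ?_⟩
      rw [Set.mem_preimage, ← hx]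
      exact hmem x
  suffices ∀ n, ∃ Γ : I → X, ContinuousOn Γ (Set.Icc 0 (t n)) ∧
      (∀ r ∈ Set.Icc 0 (t n), Γ r • o = γ r) ∧ Γ 0 = x₀ by
    obtain ⟨Γ, cont, eqOn, Γ_0⟩ := this n_max
    rw [h_max _ le_rfl] at cont eqOn
    have huniv : Set.Icc (0 : I) 1 = Set.univ := Set.eq_univ_of_forall fun r => ⟨bot_le, le_top⟩
    rw [huniv] at cont
    exact ⟨⟨Γ, continuousOn_univ.mp cont⟩, fun r => eqOn r ⟨bot_le, le_top⟩, Γ_0⟩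
  intro n
  induction n with
  | zero =>
    refine ⟨fun _ ↦ x₀, continuous_const.continuousOn, fun r hr ↦ ?_, rfl⟩
    rw [t_0, Set.Icc_self, Set.mem_singleton_iff] at hr
    rw [hr, hγ]
  | succ n ih =>
    obtain ⟨Γ, cont, eqOn, Γ_0⟩ := ih
    obtain ⟨x, t_sub⟩ := t_sub n
    have pΓtn : Γ (t n) • o = γ (t n) := eqOn _ ⟨t_0 ▸ t_mono n.zero_le, le_rfl⟩
    -- The lift and the next local section differ at `t n` by a stabilizer element; multiplying the
    -- section by it on the right makes the pieces match.
    have hstab : ((s x (γ (t n)))⁻¹ * Γ (t n)) • o = o := by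
      rw [mul_smul, pΓtn, inv_smul_eq_iff, hso]
    refine ⟨fun r ↦ if r ≤ t n then Γ r else s x (γ r) * ((s x (γ (t n)))⁻¹ * Γ (t n)),
      .if (fun r hr ↦ ?_) (cont.mono fun _ h ↦ ?_) ?_, fun r hr ↦ ?_, ?_⟩
    · cases frontier_Iic_subset _ hr.2
      rw [mul_inv_cancel_left]
    · rw [closure_le_eq continuous_id' continuous_const] at h; exact ⟨h.1.1, h.2⟩
    · refine ContinuousOn.mul ?_ continuousOn_const
      refine (hs x).comp γ.continuous.continuousOn ?_
      simp_rw [not_le]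
      intro r h
      exact t_sub ⟨closure_lt_subset_le continuous_const continuous_subtype_val h.2, h.1.2⟩
    · dsimp only
      split_ifs with h
      · exact eqOn r ⟨hr.1, h⟩
      · rw [mul_smul, hstab, hso]
    · dsimp only; rwa [if_pos (t_0 ▸ t_mono n.zero_le)]

variable [MulAction.IsPretransitive X O] {o : O} {K : Subgroup X}

/-- The map from the cosets of a subgroup of the stabilizer to the orbit. -/
def orbitMapOfLe (o : O) (K : Subgroup X) (hK : ∀ x ∈ K, x • o = o) : X ⧸ K → O :=
  Quotient.lift (fun x : X => x • o) fun x y h => by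
    have h1 : x⁻¹ * y ∈ K := QuotientGroup.leftRel_apply.1 h
    have h2 := hK _ h1
    rwa [mul_smul, inv_smul_eq_iff, eq_comm] at h2

theorem orbitMapOfLe_mk (hK : ∀ x ∈ K, x • o = o) (x : X) :
    orbitMapOfLe o K hK (x : X ⧸ K) = x • o := rfl

/-- If `X` is simply connected, `K` is path connected and `X ⧸ K` covers the orbit, then
`X ⧸ K` is simply connected. -/
theorem HasLocalSection.simplyConnectedSpace_quotient [SimplyConnectedSpace X]
    (h : HasLocalSection X o) (hKpc : IsPathConnected (K : Set X)) (hK : ∀ x ∈ K, x • o = o)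
    (hcov : IsCoveringMap (orbitMapOfLe o K hK)) : SimplyConnectedSpace (X ⧸ K) := by
  have hpc : PathConnectedSpace (X ⧸ K) :=
    Quotient.mk_surjective.pathConnectedSpace (QuotientGroup.continuous_mk (N := K))
  refine simply_connected_iff_loops_nullhomotopic.2 ⟨hpc, fun e ε => ?_⟩
  obtain ⟨x, rfl⟩ := QuotientGroup.mk_surjective e
  let p : C(X, X ⧸ K) := ⟨_, QuotientGroup.continuous_mk (N := K)⟩
  let γ : C(I, O) := ⟨fun t => orbitMapOfLe o K hK (ε t), hcov.continuous.comp ε.continuous⟩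
  obtain ⟨Γ, hΓ, hΓ0⟩ := h.exists_path_lift γ x (by simp [γ, orbitMapOfLe_mk])
  -- The lift to `X`, taken modulo `K`, and the given loop lift the same path to `O` and agree at 0,
  -- so uniqueness for the covering identifies them.
  have hlift : (fun t => (Γ t : X ⧸ K)) = ε := by
    refine hcov.eq_of_comp_eq (p.continuous.comp Γ.continuous) ε.continuous
      (funext fun t => ?_) 0 (by simp [hΓ0])
    exact hΓ t
  have h1 : x⁻¹ * Γ 1 ∈ K := by
    rw [← QuotientGroup.eq]
    have := congrFun hlift 1
    simpa using this.symm
  let q : Path x (Γ 1) := { toContinuousMap := Γ, source' := hΓ0, target' := rfl }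
  -- A path in the coset of `x` closes the lift to a loop, which contracts in `X`. Modulo `K` the
  -- added path is constant, so the contraction descends to one of `ε`.
  obtain ⟨κ, hκ⟩ := hKpc.joinedIn _ h1 1 K.one_mem
  let κ' : Path (Γ 1) x := (κ.map (continuous_const_mul x)).cast (by simp) (by simp)
  have hκ' : ∀ t, (κ' t : X ⧸ K) = (x : X ⧸ K) := by
    intro t
    have : κ' t = x * κ t := rfl
    rw [this, eq_comm, QuotientGroup.eq, inv_mul_cancel_left]
    exact hκ t
  have hΓ1 : (Γ 1 : X ⧸ K) = (x : X ⧸ K) := by simpa using hκ' 0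
  have key := (SimplyConnectedSpace.paths_homotopic (q.trans κ') (Path.refl x)).map p
  rw [Path.map_trans] at key
  rw [← Path.Homotopic.Quotient.eq] at key ⊢
  rw [Path.Homotopic.Quotient.mk_trans] at key
  have e1 : q.map p.continuous = ε.cast rfl hΓ1 := by
    ext t; exact congrFun hlift t
  have e2 : κ'.map p.continuous = (Path.refl (x : X ⧸ K)).cast hΓ1 rfl := by
    ext t; exact hκ' t
  have e3 : (Path.refl x).map p.continuous = Path.refl (x : X ⧸ K) := by
    ext t; rfl
  rw [e1, e2, e3] at key
  have gen : ∀ (z : X ⧸ K) (hz : z = (x : X ⧸ K)),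
      (Path.Homotopic.Quotient.mk (ε.cast rfl hz)).trans
        (.mk ((Path.refl (x : X ⧸ K)).cast hz rfl)) = .mk (Path.refl (x : X ⧸ K)) →
      Path.Homotopic.Quotient.mk ε = .mk (Path.refl (x : X ⧸ K)) := by
    intro z hz h
    subst hz
    simpa using h
  exact gen _ hΓ1 key

/-- The fundamental group of a homogeneous space `X / H` of a simply connected group `X`, when
`H` is the product of a path connected relatively open subgroup `K` and the image of a central
homomorphism `c`. -/
theorem HasLocalSection.nonempty_fundamentalGroup_equiv [SimplyConnectedSpace X]
    (h : HasLocalSection X o) (hcont : Continuous fun x : X => x • o)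
    (hKpc : IsPathConnected (K : Set X)) {A : Type*} [AddCommGroup A] (B : Submodule ℤ A)
    (c : A → X) (c_add : ∀ a b, c (a + b) = c a * c b) (c_comm : ∀ a x, c a * x = x * c a)
    (hB : ∀ a, c a ∈ K ↔ a ∈ B) (hstab : ∀ x : X, x • o = o ↔ ∃ a, x * c a ∈ K)
    (hopen : ∃ N ∈ 𝓝 (1 : X), ∀ x ∈ N, x • o = o → x ∈ K) (o' : O) :
    Nonempty (FundamentalGroup O o' ≃* Multiplicative (A ⧸ B)) := by
  have c_zero : c 0 = 1 := by
    have := c_add 0 0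
    rwa [add_zero, left_eq_mul] at this
  have c_neg : ∀ a, (c a)⁻¹ = c (-a) := fun a => by
    rw [inv_eq_iff_mul_eq_one, ← c_add, add_neg_cancel, c_zero]
  have hK : ∀ x ∈ K, x • o = o := fun x hx => (hstab x).2 ⟨0, by rwa [c_zero, mul_one]⟩
  -- Left multiplication by `c a`. Since `c a` is central, it depends only on `a` modulo `B`.
  let act : A ⧸ B → X ⧸ K → X ⧸ K := fun q e =>
    Quotient.liftOn₂' q e (fun a x => ((c a * x : X) : X ⧸ K)) (by
      intro a x b y hab hxy
      have hab' : -a + b ∈ B := QuotientAddGroup.leftRel_apply.1 hab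
      have hxy' : x⁻¹ * y ∈ K := QuotientGroup.leftRel_apply.1 hxy
      refine QuotientGroup.eq.2 ?_
      have : (c a * x)⁻¹ * (c b * y) = c (-a + b) * (x⁻¹ * y) := by
        rw [mul_inv_rev, c_neg, ← c_comm, mul_assoc, c_add, mul_assoc, ← mul_assoc x⁻¹ (c b),
          ← c_comm b, mul_assoc]
      rw [this]
      exact K.mul_mem ((hB _).2 hab') hxy')
  have act_mk : ∀ (a : A) (x : X), act (Submodule.Quotient.mk a) (x : X ⧸ K) =
    ((c a * x : X) : X ⧸ K) := fun _ _ => rfl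
  let _ : AddAction (A ⧸ B) (X ⧸ K) :=
    { vadd := act
      zero_vadd := fun e => by
        obtain ⟨x, rfl⟩ := QuotientGroup.mk_surjective e
        change act (Submodule.Quotient.mk 0) (x : X ⧸ K) = _
        rw [act_mk, c_zero, one_mul]
      add_vadd := fun q q' e => by
        obtain ⟨x, rfl⟩ := QuotientGroup.mk_surjective e
        obtain ⟨a, rfl⟩ := Submodule.Quotient.mk_surjective B q
        obtain ⟨b, rfl⟩ := Submodule.Quotient.mk_surjective B q'
        change act (Submodule.Quotient.mk (a + b)) (x : X ⧸ K) =
          act (Submodule.Quotient.mk a) (act (Submodule.Quotient.mk b) (x : X ⧸ K))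
        rw [act_mk, act_mk, act_mk, c_add, mul_assoc] }
  have vadd_mk : ∀ (a : A) (x : X), (Submodule.Quotient.mk a : A ⧸ B) +ᵥ (x : X ⧸ K) =
    ((c a * x : X) : X ⧸ K) := fun _ _ => rfl
  have hq := (h.isOpenQuotientMap hcont).isQuotientMap
  have hfc : Continuous (orbitMapOfLe o K hK) := hcont.quotient_lift _
  have hcov : IsAddQuotientCoveringMap (orbitMapOfLe o K hK) (A ⧸ B) :=
    { toIsQuotientMap := IsQuotientMap.of_comp QuotientGroup.continuous_mk hfc hq
      continuous_const_vadd := fun q => by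
        obtain ⟨a, rfl⟩ := Submodule.Quotient.mk_surjective B q
        refine (QuotientGroup.isQuotientMap_mk (N := K)).continuous_iff.2 ?_
        exact QuotientGroup.continuous_mk.comp (continuous_const_mul (c a))
      apply_eq_iff_mem_orbit := fun {e₁ e₂} => by
        obtain ⟨x, rfl⟩ := QuotientGroup.mk_surjective e₁
        obtain ⟨y, rfl⟩ := QuotientGroup.mk_surjective e₂
        rw [orbitMapOfLe_mk, orbitMapOfLe_mk, ← inv_smul_eq_iff, ← mul_smul, hstab]
        constructor
        · rintro ⟨a, ha⟩
          refine ⟨Submodule.Quotient.mk (-a), ?_⟩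
          change (Submodule.Quotient.mk (-a) : A ⧸ B) +ᵥ (y : X ⧸ K) = _
          rw [vadd_mk, QuotientGroup.eq, ← c_neg, mul_inv_rev, inv_inv, ← c_comm, mul_assoc, c_comm]
          exact ha
        · rintro ⟨q, hq⟩
          obtain ⟨a, rfl⟩ := Submodule.Quotient.mk_surjective B q
          change (Submodule.Quotient.mk a : A ⧸ B) +ᵥ (y : X ⧸ K) = _ at hq
          rw [vadd_mk, QuotientGroup.eq, mul_inv_rev, c_neg, ← c_comm, mul_assoc, c_comm] at hq
          exact ⟨-a, hq⟩
      disjoint := fun e => by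
        obtain ⟨x, rfl⟩ := QuotientGroup.mk_surjective e
        obtain ⟨N, hN, hNK⟩ := hopen
        have hdiv : Filter.Tendsto (fun p : X × X => p.1⁻¹ * p.2) (𝓝 1 ×ˢ 𝓝 1) (𝓝 1) := by
          have : Continuous fun p : X × X => p.1⁻¹ * p.2 := by fun_prop
          have := this.tendsto (1, 1)
          rwa [nhds_prod_eq, inv_one, one_mul] at this
        obtain ⟨W, hW, hWN⟩ := Filter.mem_prod_same_iff.1 (hdiv hN)
        -- If the translate by `a` meets this neighbourhood, some `w'⁻¹ * w` with `w, w' ∈ W`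
        -- satisfies `w'⁻¹ * w * c a ∈ K`. It fixes `o` and lies in `N`, hence in `K`; so `c a ∈ K`
        -- and `a ∈ B`.
        refine ⟨(fun w : X => ((x * w : X) : X ⧸ K)) '' W, ?_, fun q => ?_⟩
        · have hop : IsOpenMap fun w : X => ((x * w : X) : X ⧸ K) :=
            (QuotientGroup.isOpenMap_coe (N := K)).comp (isOpenMap_mul_left x)
          simpa using hop.image_mem_nhds hW
        · obtain ⟨a, rfl⟩ := Submodule.Quotient.mk_surjective B q
          rintro ⟨_, ⟨_, ⟨w, hw, rfl⟩, rfl⟩, ⟨w', hw', hww'⟩⟩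
          have hww : ((x * w' : X) : X ⧸ K) = ((c a * (x * w) : X) : X ⧸ K) := hww'
          rw [QuotientGroup.eq] at hww
          have h1 : (x * w')⁻¹ * (c a * (x * w)) = (w'⁻¹ * w) * c a := by
            rw [c_comm]; group
          rw [h1] at hww
          have h2 : w'⁻¹ * w ∈ K := hNK _ (hWN (Set.mk_mem_prod hw' hw)) ((hstab _).2 ⟨a, hww⟩)
          have h3 : c a ∈ K := (K.mul_mem_cancel_left h2).1 hww
          exact (Submodule.Quotient.mk_eq_zero B).2 ((hB a).1 h3) }
  have := h.simplyConnectedSpace_quotient hKpc hK hcov.isCoveringMap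
  obtain ⟨e, he⟩ := hcov.surjective o'
  have E := hcov.fundamentalGroupEquiv (x := o') ⟨e, he⟩
  -- The covering identifies the fundamental group with the opposite of the deck group, which is
  -- commutative.
  exact ⟨E.trans (MulOpposite.opMulEquiv (M := Multiplicative (A ⧸ B))).symm⟩

end Homogeneous

end

noncomputable section

/-! ### Determinants from traces of powers -/

section TracePow

open Polynomial

/-- Multisets of elements of an infinite field of characteristic zero are determined by their
power sums. -/
theorem Multiset.eq_of_sum_pow_eq {K : Type*} [Field K] [CharZero K] {S T : Multiset K}
    (h : ∀ r : ℕ, (S.map (· ^ r)).sum = (T.map (· ^ r)).sum) : S = T := by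
  classical
  have hpoly : ∀ p : K[X], (S.map fun x => p.eval x).sum = (T.map fun x => p.eval x).sum := by
    intro p
    induction p using Polynomial.induction_on' with
    | add p q hp hq => simp only [eval_add, Multiset.sum_map_add, hp, hq]
    | monomial r a => simp only [eval_monomial, Multiset.sum_map_mul_left, h]
  ext a
  -- Equal power sums give equal sums of any polynomial over the two multisets. The Lagrange basis
  -- polynomial at `a` turns this sum into the multiplicity of `a`, which characteristic zero
  -- recovers from its image in `K`.
  let Z : Finset K := insert a (S.toFinset ∪ T.toFinset)
  have hsum : ∀ R : Multiset K, (∀ x ∈ R, x ∈ Z) →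
      (R.map fun x => (Lagrange.basis Z id a).eval x).sum = R.count a := by
    intro R hR
    have : R.map (fun x => (Lagrange.basis Z id a).eval x) =
        R.map fun x => if a = x then (1 : K) else 0 := by
      refine Multiset.map_congr rfl fun x hx => ?_
      split_ifs with hax
      · subst hax
        exact Lagrange.eval_basis_self (Function.injective_id.injOn) (Finset.mem_insert_self _ _)
      · exact Lagrange.eval_basis_of_ne (v := id) hax (hR x hx)
    rw [this]
    clear this hR
    induction R using Multiset.induction with
    | empty => simp
    | cons b R ih =>
      rw [Multiset.map_cons, Multiset.sum_cons, ih, Multiset.count_cons]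
      split_ifs <;> push_cast <;> ring
  have hS := hsum S fun x hx => by simp [Z, hx]
  have hT := hsum T fun x hx => by simp [Z, hx]
  rw [hpoly, hT] at hS
  exact_mod_cast hS.symm

variable {n : Type*} [Fintype n] [DecidableEq n] {K : Type*} [Field K] [IsAlgClosed K]

theorem Matrix.det_sub_scalar_eq_prod (A : Matrix n n K) (a : K) :
    (A - Matrix.scalar n a).det = (A.charpoly.roots.map fun x => x - a).prod := by
  have h1 : (Matrix.scalar n a - A).det = (A.charpoly.roots.map fun x => a - x).prod := by
    rw [← Matrix.eval_charpoly]
    conv_lhs => rw [(IsAlgClosed.splits A.charpoly).eq_prod_roots_of_monic A.charpoly_monic]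
    rw [eval_multiset_prod, Multiset.map_map]
    simp
  have hcard : A.charpoly.roots.card = Fintype.card n := by
    rw [← (IsAlgClosed.splits A.charpoly).natDegree_eq_card_roots, A.charpoly_natDegree_eq_dim]
  rw [← neg_sub, Matrix.det_neg, h1, ← hcard]
  have : (A.charpoly.roots.map fun x => x - a) = A.charpoly.roots.map fun x => (-1) * (a - x) :=
    Multiset.map_congr rfl fun x _ => by ring
  rw [this, Multiset.prod_map_mul]
  simp

/-- Both sides are multiplicative in `p`, which splits into linear factors. -/
theorem Matrix.det_aeval_eq_prod (A : Matrix n n K) (p : K[X]) :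
    (aeval A p).det = (A.charpoly.roots.map fun x => p.eval x).prod := by
  have hcard : A.charpoly.roots.card = Fintype.card n := by
    rw [← (IsAlgClosed.splits A.charpoly).natDegree_eq_card_roots, A.charpoly_natDegree_eq_dim]
  have hs : ∀ s : Multiset K, (aeval A (s.map fun a => X - C a).prod).det =
      (A.charpoly.roots.map fun x => (s.map fun a => X - C a).prod.eval x).prod := by
    intro s
    induction s using Multiset.induction with
    | empty => simp
    | cons a s ih =>
      rw [Multiset.map_cons, Multiset.prod_cons, map_mul, Matrix.det_mul, ih]
      simp only [eval_mul, Multiset.prod_map_mul]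
      congr 1
      rw [map_sub, aeval_X, aeval_C]
      simpa [Matrix.algebraMap_eq_diagonal, Pi.algebraMap_def] using A.det_sub_scalar_eq_prod a
  conv_lhs => rw [(IsAlgClosed.splits p).eq_prod_roots]
  conv_rhs => rw [(IsAlgClosed.splits p).eq_prod_roots]
  simp only [eval_mul, Multiset.prod_map_mul, ← hs, map_mul, Matrix.det_mul, aeval_C, eval_C]
  congr 1
  simp [hcard, Algebra.algebraMap_eq_smul_one]

/-- Applying the preceding determinant formula to the polynomial `t - X ^ r` shows that the
eigenvalues of `A ^ r` are the `r`-th powers of those of `A`, with multiplicity. -/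
theorem Matrix.trace_pow_eq_sum (A : Matrix n n K) (r : ℕ) :
    (A ^ r).trace = (A.charpoly.roots.map (· ^ r)).sum := by
  have : (A ^ r).charpoly = ((A.charpoly.roots.map (· ^ r)).map fun a => X - C a).prod := by
    have : Infinite K := IsAlgClosed.instInfinite
    refine Polynomial.funext fun t => ?_
    have h := A.det_aeval_eq_prod (C t - X ^ r)
    rw [map_sub, aeval_C, map_pow, aeval_X] at h
    rw [Matrix.eval_charpoly, eval_multiset_prod, Multiset.map_map, Multiset.map_map]
    simpa [Matrix.algebraMap_eq_diagonal, Pi.algebraMap_def] using h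
  rw [Matrix.trace_eq_sum_roots_charpoly, this, roots_multiset_prod_X_sub_C]

/-- If the traces of all powers of `A` are those of a block diagonal matrix with blocks `B i`,
repeated `b i` times, then so is its determinant. -/
theorem Matrix.det_eq_prod_det_pow_of_trace_pow [CharZero K] {κ : Type*} [Fintype κ]
    {ν : κ → Type*} [∀ i, Fintype (ν i)] [∀ i, DecidableEq (ν i)] (A : Matrix n n K)
    (B : ∀ i, Matrix (ν i) (ν i) K) (b : κ → ℕ)
    (h : ∀ r : ℕ, (A ^ r).trace = ∑ i, b i * (B i ^ r).trace) :
    A.det = ∏ i, (B i).det ^ b i := by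
  have hm : A.charpoly.roots = ∑ i, b i • (B i).charpoly.roots := by
    refine Multiset.eq_of_sum_pow_eq fun r => ?_
    rw [← Matrix.trace_pow_eq_sum, h]
    have : ∀ s : Finset κ, ((∑ i ∈ s, b i • (B i).charpoly.roots).map (· ^ r)).sum =
        ∑ i ∈ s, b i * (B i ^ r).trace := by
      classical
      intro s
      induction s using Finset.induction with
      | empty => simp
      | insert i s hi ih =>
        rw [Finset.sum_insert hi, Finset.sum_insert hi, Multiset.map_add, Multiset.sum_add, ih,
          Multiset.map_nsmul, Multiset.sum_nsmul, Matrix.trace_pow_eq_sum, nsmul_eq_mul]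
    exact (this Finset.univ).symm
  rw [Matrix.det_eq_prod_roots_charpoly, hm, Multiset.prod_sum]
  exact Finset.prod_congr rfl fun i _ => by
    rw [Multiset.prod_nsmul, ← Matrix.det_eq_prod_roots_charpoly]

end TracePow

end

noncomputable section

namespace QuiverRep

/-! ### Endomorphisms of representations -/

variable {Q : Type u} [Quiver.{v} Q] {I : Set (PathAlgebraElement Q)} {d d' d'' : Q → ℕ}

/-- Families of linear maps between the spaces of two representations. -/
abbrev LinMaps (d d' : Q → ℕ) : Type u :=
  ∀ j : Q, (Fin (d j) → ℂ) →ₗ[ℂ] (Fin (d' j) → ℂ)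

/-- Homomorphisms of representations. -/
def IsHom (M : Rep I d) (M' : Rep I d') (f : LinMaps d d') : Prop :=
  ∀ (i j : Q) (a : i ⟶ j), f j ∘ₗ arrowMap M a = arrowMap M' a ∘ₗ f i

theorem IsHom.apply {M : Rep I d} {M' : Rep I d'} {f : LinMaps d d'} (hf : IsHom M M' f)
    {i j : Q} (a : i ⟶ j) (x : Fin (d i) → ℂ) : f j (arrowMap M a x) = arrowMap M' a (f i x) :=
  LinearMap.congr_fun (hf i j a) x

theorem IsHom.comp {M : Rep I d} {M' : Rep I d'} {M'' : Rep I d''} {g : LinMaps d' d''}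
    {f : LinMaps d d'} (hg : IsHom M' M'' g) (hf : IsHom M M' f) :
    IsHom M M'' fun j => g j ∘ₗ f j := by
  intro i j a
  refine LinearMap.ext fun x => ?_
  simp [hf.apply, hg.apply]

theorem IsHom.id (M : Rep I d) : IsHom M M fun _ => LinearMap.id := fun _ _ _ => rfl

theorem IsHom.sub {M : Rep I d} {M' : Rep I d'} {f g : LinMaps d d'} (hf : IsHom M M' f)
    (hg : IsHom M M' g) : IsHom M M' (f - g) := by
  intro i j a
  refine LinearMap.ext fun x => ?_
  simp [hf.apply, hg.apply]

theorem IsHom.add {M : Rep I d} {M' : Rep I d'} {f g : LinMaps d d'} (hf : IsHom M M' f)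
    (hg : IsHom M M' g) : IsHom M M' (f + g) := by
  intro i j a
  refine LinearMap.ext fun x => ?_
  simp [hf.apply, hg.apply]

theorem IsHom.smul {M : Rep I d} {M' : Rep I d'} {f : LinMaps d d'} (hf : IsHom M M' f)
    (c : ℂ) : IsHom M M' (c • f) := by
  intro i j a
  refine LinearMap.ext fun x => ?_
  simp [hf.apply]

theorem IsHom.zero (M : Rep I d) (M' : Rep I d') : IsHom M M' 0 := by
  intro i j a
  refine LinearMap.ext fun x => ?_
  simp

theorem IsHom.sum {M : Rep I d} {M' : Rep I d'} {κ : Type*} (s : Finset κ) {f : κ → LinMaps d d'}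
    (hf : ∀ i ∈ s, IsHom M M' (f i)) : IsHom M M' (∑ i ∈ s, f i) :=
  Finset.sum_induction f (IsHom M M') (fun _ _ => IsHom.add) (IsHom.zero M M') hf

theorem IsHom.pow_apply {M : Rep I d} {f : LinMaps d d} (hf : IsHom M M f) {i j : Q} (a : i ⟶ j)
    (n : ℕ) (x : Fin (d i) → ℂ) :
    ((f j : Module.End ℂ _) ^ n) (arrowMap M a x) =
      arrowMap M a (((f i : Module.End ℂ _) ^ n) x) := by
  induction n generalizing x with
  | zero => rfl
  | succ n ih => rw [pow_succ, pow_succ, Module.End.mul_apply, Module.End.mul_apply, hf.apply, ih]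

/-- Every endomorphism of an indecomposable representation has a single eigenvalue. -/
theorem IsIndecomposable.exists_eigenvalue {N : Rep I d} (hN : IsIndecomposable N)
    {f : LinMaps d d} (hf : IsHom N N f) :
    ∃ c : ℂ, ∀ j, IsNilpotent (f j - c • LinearMap.id : Module.End ℂ (Fin (d j) → ℂ)) := by
  obtain ⟨⟨j₀, hj₀⟩, hdec⟩ := hN
  have : Nonempty (Fin (d j₀)) := ⟨⟨0, Nat.pos_of_ne_zero hj₀⟩⟩
  obtain ⟨c, hc⟩ := Module.End.exists_eigenvalue (f j₀ : Module.End ℂ (Fin (d j₀) → ℂ))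
  refine ⟨c, ?_⟩
  let g : LinMaps d d := f - c • (fun _ => LinearMap.id : LinMaps d d)
  have hg : IsHom N N g := hf.sub ((IsHom.id N).smul c)
  let G : ∀ j, Module.End ℂ (Fin (d j) → ℂ) := g
  -- Fitting decomposition of `g = f - c`: the generalized kernel and the stable image are
  -- complementary subrepresentations. The kernel is nonzero at `j₀`, so indecomposability removes
  -- the image at every vertex.
  have hU : IsSubrep N fun j => ⨆ n, LinearMap.ker (G j ^ n) := by
    intro i j a x hx
    have hmono : ∀ i, Monotone fun n => LinearMap.ker (G i ^ n) := fun i =>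
      monotone_nat_of_le_succ fun n y hy => by
        rw [LinearMap.mem_ker] at hy ⊢
        rw [pow_succ', Module.End.mul_apply, hy, map_zero]
    rw [Submodule.mem_iSup_of_directed _ (hmono _).directed_le] at hx ⊢
    obtain ⟨n, hn⟩ := hx
    refine ⟨n, ?_⟩
    rw [LinearMap.mem_ker] at hn ⊢
    rw [hg.pow_apply, hn, map_zero]
  have hW : IsSubrep N fun j => ⨅ n, LinearMap.range (G j ^ n) := by
    intro i j a x hx
    rw [Submodule.mem_iInf] at hx ⊢
    intro n
    obtain ⟨y, rfl⟩ := hx n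
    exact ⟨arrowMap N a y, hg.pow_apply a n y⟩
  have hcompl := fun j => (G j).isCompl_iSup_ker_pow_iInf_range_pow
  rcases hdec _ _ hU hW hcompl with h | h
  · exfalso
    obtain ⟨x, hx⟩ := hc.exists_hasEigenvector
    refine hx.2 ?_
    have hmem : x ∈ ⨆ n, LinearMap.ker (G j₀ ^ n) := by
      refine Submodule.mem_iSup_of_mem 1 ?_
      rw [pow_one, LinearMap.mem_ker]
      have := hx.apply_eq_smul
      simp [G, g, this]
    rw [h j₀] at hmem
    simpa using hmem
  · intro j
    obtain ⟨n, hn⟩ := Filter.eventually_atTop.1 (G j).eventually_iSup_ker_pow_eq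
    have htop : ⨆ n, LinearMap.ker (G j ^ n) = ⊤ := by
      have := (hcompl j).sup_eq_top
      rwa [h j, sup_bot_eq] at this
    exact ⟨n, LinearMap.ker_eq_top.1 ((hn n le_rfl).symm.trans htop)⟩

/-- The normalized trace at a vertex of the support. On endomorphisms it is the eigenvalue. -/
def IsIndecomposable.scalar {N : Rep I d} (hN : IsIndecomposable N) : LinMaps d d →ₗ[ℂ] ℂ :=
  (d hN.1.choose : ℂ)⁻¹ • (LinearMap.trace ℂ (Fin (d hN.1.choose) → ℂ) ∘ₗ
    LinearMap.proj (φ := fun j => (Fin (d j) → ℂ) →ₗ[ℂ] (Fin (d j) → ℂ)) hN.1.choose)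

theorem trace_eq_of_isNilpotent_sub {n : ℕ} {f : Module.End ℂ (Fin n → ℂ)} {c : ℂ}
    (h : IsNilpotent (f - c • LinearMap.id)) : LinearMap.trace ℂ _ f = n * c := by
  have := (LinearMap.isNilpotent_trace_of_isNilpotent h).eq_zero
  rw [map_sub, map_smul, LinearMap.trace_id, sub_eq_zero] at this
  rw [this]
  simp [mul_comm]

theorem isUnit_of_isNilpotent_sub {n : ℕ} {f : Module.End ℂ (Fin n → ℂ)} {c : ℂ} (hc : c ≠ 0)
    (h : IsNilpotent (f - c • LinearMap.id)) : IsUnit f := by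
  have hu : IsUnit (c • LinearMap.id : Module.End ℂ (Fin n → ℂ)) := by
    refine ⟨⟨c • LinearMap.id, c⁻¹ • LinearMap.id, ?_, ?_⟩, rfl⟩ <;>
      refine LinearMap.ext fun x => ?_ <;> simp [Module.End.mul_apply, smul_smul, hc]
  have hcomm : Commute (c • LinearMap.id : Module.End ℂ (Fin n → ℂ)) (f - c • LinearMap.id) := by
    change _ * _ = _ * _
    refine LinearMap.ext fun x => ?_
    simp [Module.End.mul_apply, smul_sub]
  have := h.isUnit_add_right_of_commute hu hcomm.symm
  rwa [sub_add_cancel] at this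

section Scalar

variable {N : Rep I d} (hN : IsIndecomposable N)

theorem IsIndecomposable.scalar_eq {f : LinMaps d d} {c : ℂ}
    (h : ∀ j, IsNilpotent (f j - c • LinearMap.id : Module.End ℂ (Fin (d j) → ℂ))) :
    hN.scalar f = c := by
  have hne : (d hN.1.choose : ℂ) ≠ 0 := by exact_mod_cast hN.1.choose_spec
  have := trace_eq_of_isNilpotent_sub (h hN.1.choose)
  simp [IsIndecomposable.scalar, this, hne]

theorem IsIndecomposable.isNilpotent_sub {f : LinMaps d d} (hf : IsHom N N f) (j : Q) :
    IsNilpotent (f j - hN.scalar f • LinearMap.id : Module.End ℂ (Fin (d j) → ℂ)) := by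
  obtain ⟨c, hc⟩ := hN.exists_eigenvalue hf
  rw [hN.scalar_eq hc]
  exact hc j

theorem IsIndecomposable.trace_eq {f : LinMaps d d} (hf : IsHom N N f) (j : Q) :
    LinearMap.trace ℂ _ (f j) = d j * hN.scalar f :=
  trace_eq_of_isNilpotent_sub (hN.isNilpotent_sub hf j)

theorem IsIndecomposable.scalar_id : hN.scalar (fun _ => LinearMap.id) = 1 :=
  hN.scalar_eq fun j => by simp

/-- Subtracting the eigenvalues leaves endomorphisms `p`, `q` of eigenvalue 0. Their composite also
has eigenvalue 0, for otherwise the nilpotent `p` would be invertible on a nonzero space. -/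
theorem IsIndecomposable.scalar_comp {f g : LinMaps d d} (hf : IsHom N N f) (hg : IsHom N N g) :
    hN.scalar (fun j => f j ∘ₗ g j) = hN.scalar f * hN.scalar g := by
  set a := hN.scalar f
  set b := hN.scalar g
  let p : LinMaps d d := f - a • (fun _ => LinearMap.id : LinMaps d d)
  let q : LinMaps d d := g - b • (fun _ => LinearMap.id : LinMaps d d)
  have hp : IsHom N N p := hf.sub ((IsHom.id N).smul a)
  have hq : IsHom N N q := hg.sub ((IsHom.id N).smul b)
  have hp0 : hN.scalar p = 0 := by
    rw [map_sub, map_smul, hN.scalar_id]; simp [a]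
  have hq0 : hN.scalar q = 0 := by
    rw [map_sub, map_smul, hN.scalar_id]; simp [b]
  have hpq : hN.scalar (fun j => p j ∘ₗ q j) = 0 := by
    by_contra hne
    obtain ⟨j, hj⟩ := hN.1
    have : Nonempty (Fin (d j)) := ⟨⟨0, Nat.pos_of_ne_zero hj⟩⟩
    have hu := isUnit_of_isNilpotent_sub hne (hN.isNilpotent_sub (hp.comp hq) j)
    have hnil := hN.isNilpotent_sub hp j
    rw [hp0, zero_smul, sub_zero] at hnil
    have hpu : IsUnit (p j : Module.End ℂ (Fin (d j) → ℂ)) :=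
      isUnit_of_mul_isUnit_left (x := (p j : Module.End ℂ (Fin (d j) → ℂ))) (y := q j) hu
    exact hnil.not_isUnit hpu
  have hdecomp : (fun j => f j ∘ₗ g j) = (fun j => p j ∘ₗ q j) + a • q + b • p +
      (a * b) • (fun _ => LinearMap.id : LinMaps d d) := by
    funext j
    refine LinearMap.ext fun x => ?_
    simp [p, q, mul_smul]
    module
  rw [hdecomp, map_add, map_add, map_add, map_smul, map_smul, map_smul, hpq, hp0, hq0,
    hN.scalar_id]
  simp

/-- An endomorphism of an indecomposable representation factoring through a non-isomorphic one
is nilpotent. -/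
theorem IsIndecomposable.scalar_comp_eq_zero {N' : Rep I d'} (hN' : IsIndecomposable N')
    (hiso : ¬ IsIsomorphic N' N) {f : LinMaps d' d} {g : LinMaps d d'} (hf : IsHom N' N f)
    (hg : IsHom N N' g) : hN.scalar (fun j => f j ∘ₗ g j) = 0 := by
  by_contra hne
  have hfg := hf.comp hg
  have hgf := hg.comp hf
  -- The traces of `f g` and `g f` agree at a vertex of the support, so both eigenvalues are
  -- nonzero. Both composites are then invertible, and `f` would be an isomorphism.
  have hne' : hN'.scalar (fun j => g j ∘ₗ f j) ≠ 0 := by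
    intro h0
    obtain ⟨j, hj⟩ := hN.1
    have h1 := hN.trace_eq hfg j
    have h2 := hN'.trace_eq hgf j
    rw [LinearMap.trace_comp_comm', h0, mul_zero] at h2
    rw [h2, zero_eq_mul] at h1
    rcases h1 with h1 | h1
    · exact hj (by exact_mod_cast h1)
    · exact hne h1
  have hbij : ∀ j, Function.Bijective (f j) := by
    intro j
    have h1 := (Module.End.isUnit_iff _).1
      (isUnit_of_isNilpotent_sub hne (hN.isNilpotent_sub hfg j))
    have h2 := (Module.End.isUnit_iff _).1
      (isUnit_of_isNilpotent_sub hne' (hN'.isNilpotent_sub hgf j))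
    exact ⟨Function.Injective.of_comp (f := g j) h2.injective,
      Function.Surjective.of_comp (g := g j) h1.surjective⟩
  exact hiso ⟨fun j => LinearEquiv.ofBijective (f j) (hbij j), fun i j a x => hf.apply a x⟩

end Scalar

/-! ### The Levi quotient of the endomorphism algebra -/

namespace IsDecomposition

variable {M : Rep I d} {k : ℕ} {β : Fin k → Q → ℕ} {N : ∀ i, Rep I (β i)} {m : Fin k → ℕ}
  (hN : IsDecomposition M N m)

/-- The inclusion of a summand. -/
def inc (i : Fin k) (s : Fin (m i)) : LinMaps (β i) d := fun j =>
  ((hN.iso.choose j).symm : _ →ₗ[ℂ] _) ∘ₗ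
    LinearMap.single ℂ (fun i => Fin (m i) → Fin (β i j) → ℂ) i ∘ₗ
      LinearMap.single ℂ (fun _ => Fin (β i j) → ℂ) s

/-- The projection to a summand. -/
def prj (i : Fin k) (s : Fin (m i)) : LinMaps d (β i) := fun j =>
  LinearMap.proj (φ := fun _ => Fin (β i j) → ℂ) s ∘ₗ
    LinearMap.proj (φ := fun i => Fin (m i) → Fin (β i j) → ℂ) i ∘ₗ
      (hN.iso.choose j : _ →ₗ[ℂ] _)

theorem prj_inc_self (i : Fin k) (s : Fin (m i)) (j : Q) (x : Fin (β i j) → ℂ) :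
    hN.prj i s j (hN.inc i s j x) = x := by
  simp [prj, inc]

theorem prj_inc_of_ne {i : Fin k} {s s' : Fin (m i)} (h : s ≠ s') (j : Q) (x : Fin (β i j) → ℂ) :
    hN.prj i s j (hN.inc i s' j x) = 0 := by
  simp [prj, inc, h]

theorem prj_inc_of_ne' {i i' : Fin k} (h : i ≠ i') (s : Fin (m i)) (s' : Fin (m i')) (j : Q)
    (x : Fin (β i' j) → ℂ) : hN.prj i s j (hN.inc i' s' j x) = 0 := by
  simp [prj, inc, h]

theorem isHom_prj (i : Fin k) (s : Fin (m i)) : IsHom M (N i) (hN.prj i s) := by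
  intro j l a
  refine LinearMap.ext fun x => ?_
  exact hN.iso.choose_spec j l a x i s

theorem ext_prj {j : Q} {x y : Fin (d j) → ℂ} (h : ∀ i s, hN.prj i s j x = hN.prj i s j y) :
    x = y :=
  (hN.iso.choose j).injective (funext fun i => funext fun s => h i s)

theorem isHom_inc (i : Fin k) (s : Fin (m i)) : IsHom (N i) M (hN.inc i s) := by
  intro j l a
  refine LinearMap.ext fun x => ?_
  refine hN.ext_prj fun i' s' => ?_
  simp only [LinearMap.comp_apply]
  rw [(hN.isHom_prj i' s').apply]
  by_cases hi : i' = i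
  · subst hi
    by_cases hs : s' = s
    · subst hs
      rw [prj_inc_self, prj_inc_self]
    · rw [prj_inc_of_ne _ hs, prj_inc_of_ne _ hs, map_zero]
  · rw [prj_inc_of_ne' _ hi, prj_inc_of_ne' _ hi, map_zero]

theorem sum_inc_prj (j : Q) (x : Fin (d j) → ℂ) :
    ∑ i, ∑ s, hN.inc i s j (hN.prj i s j x) = x := by
  refine hN.ext_prj fun i s => ?_
  rw [map_sum, Finset.sum_eq_single i, map_sum, Finset.sum_eq_single s, prj_inc_self]
  · intro s' _ h
    exact hN.prj_inc_of_ne h.symm _ _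
  · simp
  · intro i' _ h
    rw [map_sum]
    exact Finset.sum_eq_zero fun s' _ => hN.prj_inc_of_ne' h.symm _ _ _ _
  · simp

/-- The action of an endomorphism on the `i`-th multiplicity space. -/
def multMatrix (i : Fin k) : LinMaps d d →ₗ[ℂ] Matrix (Fin (m i)) (Fin (m i)) ℂ where
  toFun f := Matrix.of fun s s' =>
    (hN.indecomposable i).scalar fun j => hN.prj i s j ∘ₗ f j ∘ₗ hN.inc i s' j
  map_add' f g := by
    ext s s'
    simp only [Matrix.of_apply, Matrix.add_apply, ← map_add]
    congr 1
    funext j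
    simp [LinearMap.add_comp, LinearMap.comp_add]
  map_smul' c f := by
    ext s s'
    simp only [Matrix.of_apply, Matrix.smul_apply, RingHom.id_apply, ← map_smul]
    congr 1
    funext j
    simp [LinearMap.smul_comp, LinearMap.comp_smul]

theorem multMatrix_apply (i : Fin k) (f : LinMaps d d) (s s' : Fin (m i)) :
    hN.multMatrix i f s s' =
      (hN.indecomposable i).scalar fun j => hN.prj i s j ∘ₗ f j ∘ₗ hN.inc i s' j := rfl

theorem isHom_block {f : LinMaps d d} (hf : IsHom M M f) (i i' : Fin k) (s : Fin (m i))
    (s' : Fin (m i')) : IsHom (N i') (N i) fun j => hN.prj i s j ∘ₗ f j ∘ₗ hN.inc i' s' j :=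
  (hN.isHom_prj i s).comp (hf.comp (hN.isHom_inc i' s'))

/-- Inserting the decomposition of the identity writes a block of the composite as a sum over all
intermediate summands. Those not isomorphic to `N i` contribute scalar 0, and the rest give the
matrix product. -/
theorem multMatrix_comp {f g : LinMaps d d} (hf : IsHom M M f) (hg : IsHom M M g) (i : Fin k) :
    hN.multMatrix i (fun j => f j ∘ₗ g j) = hN.multMatrix i f * hN.multMatrix i g := by
  ext s s'
  have hsum : (fun j => hN.prj i s j ∘ₗ (f j ∘ₗ g j) ∘ₗ hN.inc i s' j) =
      ∑ l, ∑ t, (fun j => (hN.prj i s j ∘ₗ f j ∘ₗ hN.inc l t j) ∘ₗ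
        (hN.prj l t j ∘ₗ g j ∘ₗ hN.inc i s' j) : LinMaps (β i) (β i)) := by
    funext j
    refine LinearMap.ext fun x => ?_
    have := congrArg (fun y => hN.prj i s j (f j y)) (hN.sum_inc_prj j (g j (hN.inc i s' j x)))
    simp only [map_sum] at this
    simp [Finset.sum_apply, LinearMap.sum_apply, this]
  rw [multMatrix_apply, hsum, map_sum, Matrix.mul_apply, Finset.sum_eq_single i]
  · rw [map_sum]
    refine Finset.sum_congr rfl fun t _ => ?_
    exact (hN.indecomposable i).scalar_comp (hN.isHom_block hf i i s t) (hN.isHom_block hg i i t s')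
  · intro l _ hl
    rw [map_sum]
    exact Finset.sum_eq_zero fun t _ => (hN.indecomposable i).scalar_comp_eq_zero
      (hN.indecomposable l) (hN.not_isomorphic l i hl) (hN.isHom_block hf i l s t)
      (hN.isHom_block hg l i t s')
  · simp

theorem trace_eq_sum {f : LinMaps d d} (hf : IsHom M M f) (j : Q) :
    LinearMap.trace ℂ _ (f j) = ∑ i, β i j * (hN.multMatrix i f).trace := by
  have h1 : f j = ∑ i, ∑ s, (f j ∘ₗ hN.inc i s j) ∘ₗ hN.prj i s j := by
    refine LinearMap.ext fun x => ?_
    conv_lhs => rw [← hN.sum_inc_prj j x]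
    simp only [map_sum, LinearMap.sum_apply, LinearMap.comp_apply]
  conv_lhs => rw [h1]
  simp only [map_sum, Matrix.trace, Finset.mul_sum, Matrix.diag_apply]
  refine Finset.sum_congr rfl fun i _ => Finset.sum_congr rfl fun s _ => ?_
  rw [LinearMap.trace_comp_comm']
  exact (hN.indecomposable i).trace_eq (hN.isHom_block hf i i s s) j

/-- Endomorphisms of `M` acting by a scalar on each summand. -/
def diagMap (z : ∀ i, Fin (m i) → ℂ) : LinMaps d d :=
  ∑ i, ∑ s, z i s • fun j => hN.inc i s j ∘ₗ hN.prj i s j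

theorem diagMap_apply (z : ∀ i, Fin (m i) → ℂ) (j : Q) (x : Fin (d j) → ℂ) :
    hN.diagMap z j x = ∑ i, ∑ s, z i s • hN.inc i s j (hN.prj i s j x) := by
  simp [diagMap, Finset.sum_apply, LinearMap.sum_apply]

theorem isHom_diagMap (z : ∀ i, Fin (m i) → ℂ) : IsHom M M (hN.diagMap z) :=
  IsHom.sum _ fun i _ => IsHom.sum _ fun s _ =>
    ((hN.isHom_inc i s).comp (hN.isHom_prj i s)).smul _

theorem diagMap_one : hN.diagMap (fun _ _ => 1) = fun _ => LinearMap.id := by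
  funext j
  refine LinearMap.ext fun x => ?_
  rw [diagMap_apply]
  simpa using hN.sum_inc_prj j x

theorem diagMap_inc (z : ∀ i, Fin (m i) → ℂ) (i : Fin k) (s : Fin (m i)) (j : Q)
    (x : Fin (β i j) → ℂ) : hN.diagMap z j (hN.inc i s j x) = z i s • hN.inc i s j x := by
  rw [diagMap_apply, Finset.sum_eq_single i, Finset.sum_eq_single s, prj_inc_self]
  · intro s' _ h
    rw [prj_inc_of_ne _ h, map_zero, smul_zero]
  · simp
  · intro i' _ h
    exact Finset.sum_eq_zero fun s' _ => by rw [prj_inc_of_ne' _ h, map_zero, smul_zero]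
  · simp

theorem multMatrix_diagMap (z : ∀ i, Fin (m i) → ℂ) (i : Fin k) :
    hN.multMatrix i (hN.diagMap z) = Matrix.diagonal (z i) := by
  ext s s'
  have h : (fun j => hN.prj i s j ∘ₗ hN.diagMap z j ∘ₗ hN.inc i s' j) =
      (if s = s' then z i s else 0) • fun j => (LinearMap.id : Module.End ℂ (Fin (β i j) → ℂ)) := by
    funext j
    refine LinearMap.ext fun x => ?_
    simp only [LinearMap.comp_apply, diagMap_inc, map_smul]
    split_ifs with h
    · subst h
      simp [prj_inc_self]
    · simp [hN.prj_inc_of_ne h]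
  rw [multMatrix_apply, h, map_smul, IsIndecomposable.scalar_id, Matrix.diagonal_apply]
  simp

theorem multMatrix_id (i : Fin k) : hN.multMatrix i (fun _ => LinearMap.id) = 1 := by
  rw [← hN.diagMap_one, multMatrix_diagMap]
  rfl

end IsDecomposition

/-! ### Characters of the automorphism group -/

/-- A family of square matrices commuting with all arrows. -/
def IsEndo (M : Rep I d) (A : ∀ j, Matrix (Fin (d j)) (Fin (d j)) ℂ) : Prop :=
  IsHom M M fun j => Matrix.toLin' (A j)

theorem isEndo_iff {M : Rep I d} {A : ∀ j, Matrix (Fin (d j)) (Fin (d j)) ℂ} :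
    IsEndo M A ↔ ∀ (i j : Q) (a : i ⟶ j), A j * M.1 i j a = M.1 i j a * A i := by
  refine forall_congr' fun i => forall_congr' fun j => forall_congr' fun a => ?_
  have : arrowMap M a = Matrix.toLin' (M.1 i j a) := rfl
  rw [this, ← Matrix.toLin'_mul, ← Matrix.toLin'_mul]
  exact Matrix.toLin'.injective.eq_iff

theorem IsEndo.mul {M : Rep I d} {A B : ∀ j, Matrix (Fin (d j)) (Fin (d j)) ℂ}
    (hA : IsEndo M A) (hB : IsEndo M B) : IsEndo M fun j => A j * B j := by
  have := IsHom.comp hA hB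
  simpa only [IsEndo, Matrix.toLin'_mul] using this

theorem IsEndo.one (M : Rep I d) : IsEndo M fun _ => 1 := by
  have := IsHom.id M
  simpa only [IsEndo, Matrix.toLin'_one] using this

theorem IsEndo.pow {M : Rep I d} {A : ∀ j, Matrix (Fin (d j)) (Fin (d j)) ℂ}
    (hA : IsEndo M A) (n : ℕ) : IsEndo M fun j => A j ^ n := by
  induction n with
  | zero => simpa using IsEndo.one M
  | succ n ih => simpa only [pow_succ] using ih.mul hA

namespace IsDecomposition

variable {M : Rep I d} {k : ℕ} {β : Fin k → Q → ℕ} {N : ∀ i, Rep I (β i)} {m : Fin k → ℕ}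
  (hN : IsDecomposition M N m)

/-- The determinant of the action on the `i`-th multiplicity space. -/
def char (i : Fin k) (A : ∀ j, Matrix (Fin (d j)) (Fin (d j)) ℂ) : ℂ :=
  (hN.multMatrix i fun j => Matrix.toLin' (A j)).det

theorem char_mul {A B : ∀ j, Matrix (Fin (d j)) (Fin (d j)) ℂ} (hA : IsEndo M A)
    (hB : IsEndo M B) (i : Fin k) :
    hN.char i (fun j => A j * B j) = hN.char i A * hN.char i B := by
  rw [char, char, char, ← Matrix.det_mul, ← hN.multMatrix_comp hA hB]
  simp only [Matrix.toLin'_mul]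

theorem char_one (i : Fin k) : hN.char i (fun _ => 1) = 1 := by
  simp only [char, Matrix.toLin'_one, multMatrix_id, Matrix.det_one]

theorem multMatrix_pow {A : ∀ j, Matrix (Fin (d j)) (Fin (d j)) ℂ} (hA : IsEndo M A) (i : Fin k)
    (n : ℕ) : (hN.multMatrix i fun j => Matrix.toLin' (A j ^ n)) =
      (hN.multMatrix i fun j => Matrix.toLin' (A j)) ^ n := by
  induction n with
  | zero => simp only [pow_zero, Matrix.toLin'_one, multMatrix_id]
  | succ n ih =>
    rw [pow_succ, ← ih, ← hN.multMatrix_comp (hA.pow n) hA]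
    simp only [pow_succ, Matrix.toLin'_mul]

/-- By `trace_eq_sum`, the powers of `A j` have the traces of a block diagonal matrix in which the
`i`-th multiplicity matrix is repeated `β i j` times; the traces of all powers determine the
determinant. -/
theorem det_eq_prod_char {A : ∀ j, Matrix (Fin (d j)) (Fin (d j)) ℂ} (hA : IsEndo M A) (j : Q) :
    (A j).det = ∏ i, hN.char i A ^ β i j := by
  refine Matrix.det_eq_prod_det_pow_of_trace_pow (A j) _ (fun i => β i j) fun r => ?_
  rw [← Matrix.trace_toLin'_eq, hN.trace_eq_sum (hA.pow r) j]
  exact Finset.sum_congr rfl fun i _ => by rw [hN.multMatrix_pow hA]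

theorem continuous_char [Finite Q] (i : Fin k) : Continuous (hN.char i) := by
  let F : (∀ j, Matrix (Fin (d j)) (Fin (d j)) ℂ) →ₗ[ℂ] Matrix (Fin (m i)) (Fin (m i)) ℂ :=
    hN.multMatrix i ∘ₗ LinearMap.pi fun j => Matrix.toLin'.toLinearMap ∘ₗ LinearMap.proj j
  exact (LinearMap.continuous_of_finiteDimensional F).matrix_det

/-- The torus acting with weight `z i` on one copy of `N i` for every `i`. -/
def torus (z : Fin k → ℂ) (j : Q) : Matrix (Fin (d j)) (Fin (d j)) ℂ :=
  LinearMap.toMatrix' (hN.diagMap (fun i s => if (s : ℕ) = 0 then z i else 1) j)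

theorem isEndo_torus (z : Fin k → ℂ) : IsEndo M (hN.torus z) := by
  have := hN.isHom_diagMap fun i s => if (s : ℕ) = 0 then z i else 1
  simpa only [IsEndo, torus, Matrix.toLin'_toMatrix'] using this

theorem torus_one : hN.torus 1 = fun _ => 1 := by
  funext j
  have := hN.diagMap_one
  simp [torus, this]

theorem char_torus (z : Fin k → ℂ) (i : Fin k) : hN.char i (hN.torus z) = z i := by
  have h : ∀ s : Fin (m i), (s : ℕ) = 0 ↔ s = ⟨0, hN.mult_pos i⟩ := fun s => by
    rw [Fin.ext_iff]
  simp only [char, torus, Matrix.toLin'_toMatrix', multMatrix_diagMap, Matrix.det_diagonal, h]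
  simp

theorem continuous_torus (j : Q) : Continuous fun z => hN.torus z j := by
  refine continuous_matrix fun r c => ?_
  have h : ∀ z, hN.torus z j r c = ∑ i, ∑ s : Fin (m i), (if (s : ℕ) = 0 then z i else 1) *
      hN.inc i s j (hN.prj i s j (Pi.single c 1)) r := by
    intro z
    rw [torus, LinearMap.toMatrix'_apply, diagMap_apply, Finset.sum_apply]
    simp only [Finset.sum_apply, Pi.smul_apply, smul_eq_mul]
  simp only [h]
  refine continuous_finsetSum _ fun i _ => continuous_finsetSum _ fun s _ =>
    Continuous.mul ?_ continuous_const
  split_ifs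
  · exact continuous_apply i
  · exact continuous_const

end IsDecomposition

end QuiverRep

end

noncomputable section

open Topology

namespace QuiverRep

/-! ### Local sections of the orbit map -/

variable {Q : Type u} [Quiver.{v} Q] {d : Q → ℕ}

/-- `RepSpace Q d` with its vector space structure. -/
abbrev ArrowSpace (Q : Type u) [Quiver.{v} Q] (d : Q → ℕ) : Type (max u v) :=
  ∀ i j : Q, (i ⟶ j) → Matrix (Fin (d j)) (Fin (d i)) ℂ

/-- The set of arrows may be infinite, so the space may be infinite-dimensional. Its coordinates
still separate points, which allows functionals on finite-dimensional subspaces to be extended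
continuously. -/
instance : SeparatingDual ℂ (ArrowSpace Q d) where
  exists_ne_zero' x hx := by
    obtain ⟨i, hi⟩ := Function.ne_iff.1 hx
    obtain ⟨j, hj⟩ := Function.ne_iff.1 hi
    obtain ⟨a, ha⟩ := Function.ne_iff.1 hj
    obtain ⟨r, hr⟩ := Function.ne_iff.1 ha
    obtain ⟨c, hc⟩ := Function.ne_iff.1 hr
    refine ⟨⟨⟨⟨fun y : ArrowSpace Q d => y i j a r c, fun _ _ => rfl⟩, fun _ _ => rfl⟩, ?_⟩, hc⟩
    exact (continuous_apply_apply r c).comp ((continuous_apply a).comp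
      ((continuous_apply j).comp (continuous_apply i)))

/-- The linear map `φ ↦ φ M - R φ`, whose kernel consists of the homomorphisms from `M` to `R`. -/
def homDefect (M R : ArrowSpace Q d) :
    (∀ j, Matrix (Fin (d j)) (Fin (d j)) ℂ) →ₗ[ℂ] ArrowSpace Q d where
  toFun φ := fun i j a => φ j * M i j a - R i j a * φ i
  map_add' φ ψ := by
    funext i j a
    simp only [Pi.add_apply, Matrix.add_mul, Matrix.mul_add]
    abel
  map_smul' c φ := by
    funext i j a
    simp [Matrix.smul_mul, Matrix.mul_smul, smul_sub]

theorem homDefect_apply (M R : ArrowSpace Q d) (φ : ∀ j, Matrix (Fin (d j)) (Fin (d j)) ℂ)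
    (i j : Q) (a : i ⟶ j) : homDefect M R φ i j a = φ j * M i j a - R i j a * φ i := rfl

theorem continuous_homDefect (M : ArrowSpace Q d) (φ : ∀ j, Matrix (Fin (d j)) (Fin (d j)) ℂ) :
    Continuous fun R => homDefect M R φ := by
  refine continuous_pi fun i => continuous_pi fun j => continuous_pi fun a => ?_
  have h : Continuous fun R : ArrowSpace Q d => R i j a :=
    (continuous_apply a).comp ((continuous_apply j).comp (continuous_apply i))
  exact continuous_const.sub (h.matrix_mul continuous_const)

/-- Left multiplication by `g` carries End(M) injectively into Hom(M, g • M). -/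
theorem finrank_ker_homDefect_le [Finite Q] (M : RepSpace Q d) (g : GLd d) :
    Module.finrank ℂ (LinearMap.ker (homDefect M M)) ≤
      Module.finrank ℂ (LinearMap.ker (homDefect M (g • M))) := by
  let e : (∀ j, Matrix (Fin (d j)) (Fin (d j)) ℂ) →ₗ[ℂ] ∀ j, Matrix (Fin (d j)) (Fin (d j)) ℂ :=
    { toFun := fun φ j => (g j).val * φ j
      map_add' := fun φ ψ => by funext j; simp [Matrix.mul_add]
      map_smul' := fun c φ => by funext j; simp }
  have he : Function.Injective e := by
    intro φ ψ h
    funext j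
    exact (g j).isUnit.mul_left_cancel (congrFun h j)
  rw [(Submodule.equivMapOfInjective e he _).finrank_eq]
  refine Submodule.finrank_mono ?_
  rintro _ ⟨φ, hφ, rfl⟩
  rw [SetLike.mem_coe, LinearMap.mem_ker] at hφ
  rw [LinearMap.mem_ker]
  funext i j a
  have h := congrFun (congrFun (congrFun hφ i) j) a
  change φ j * M i j a - M i j a * φ i = 0 at h
  have hinv : ((g i)⁻¹).val * (g i).val = 1 := (g i).inv_mul
  change (g j).val * φ j * M i j a -
    (g j).val * M i j a * ((g i)⁻¹).val * ((g i).val * φ i) = 0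
  rw [Matrix.mul_assoc _ ((g i)⁻¹).val, ← Matrix.mul_assoc ((g i)⁻¹).val, hinv, Matrix.one_mul,
    Matrix.mul_assoc, Matrix.mul_assoc, ← Matrix.mul_sub]
  rw [h, Matrix.mul_zero]

/-- Near `M`, the points `R` with at least as many homomorphisms from `M` as `M` itself admit a
homomorphism from `M` depending continuously on `R`. -/
theorem exists_continuous_hom [Finite Q] (M : ArrowSpace Q d) :
    ∃ U : Set (ArrowSpace Q d), IsOpen U ∧ M ∈ U ∧
      ∃ s : ArrowSpace Q d → ∀ j, Matrix (Fin (d j)) (Fin (d j)) ℂ, ContinuousOn s U ∧ s M = 1 ∧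
        ∀ R ∈ U, Module.finrank ℂ (LinearMap.ker (homDefect M M)) ≤
          Module.finrank ℂ (LinearMap.ker (homDefect M R)) → homDefect M R (s R) = 0 := by
  let V := ∀ j, Matrix (Fin (d j)) (Fin (d j)) ℂ
  obtain ⟨C, hC⟩ := Submodule.exists_isCompl (LinearMap.ker (homDefect M M))
  let r := Module.finrank ℂ C
  let ι : (Fin r → ℂ) →ₗ[ℂ] V := C.subtype ∘ₗ (Module.finBasis ℂ C).equivFun.symm.toLinearMap
  have hι : ∀ w, ι w ∈ C := fun w => ((Module.finBasis ℂ C).equivFun.symm w).2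
  have hinj : Function.Injective (homDefect M M ∘ₗ ι) := by
    rw [← LinearMap.ker_eq_bot, LinearMap.ker_eq_bot']
    intro w hw
    have h1 : ι w ∈ LinearMap.ker (homDefect M M) := hw
    have h2 : ι w = 0 := (Submodule.disjoint_def.1 hC.disjoint) _ h1 (hι w)
    have h3 : (Module.finBasis ℂ C).equivFun.symm w = 0 := Subtype.ext h2
    exact (LinearEquiv.map_eq_zero_iff _).1 h3
  -- The defect map is injective on the complement `C` of End(M); these functionals recover the `r`
  -- coordinates on `C` from its values.
  have hf : ∀ p : Fin r, ∃ f : ArrowSpace Q d →L[ℂ] ℂ, ∀ w, f (homDefect M M (ι w)) = w p := by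
    intro p
    obtain ⟨f, hf⟩ := SeparatingDual.dualMap_surjective_iff.2 hinj
      (LinearMap.proj p : (Fin r → ℂ) →ₗ[ℂ] ℂ)
    exact ⟨f, fun w => LinearMap.congr_fun hf w⟩
  choose f hf using hf
  let PL : ArrowSpace Q d → V →ₗ[ℂ] (Fin r → ℂ) := fun R =>
    LinearMap.pi (fun p => (f p : ArrowSpace Q d →ₗ[ℂ] ℂ)) ∘ₗ homDefect M R
  have hPL : ∀ φ, Continuous fun R => PL R φ := fun φ =>
    continuous_pi fun p => (f p).continuous.comp (continuous_homDefect M φ)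
  let D : ArrowSpace Q d → Matrix (Fin r) (Fin r) ℂ := fun R => LinearMap.toMatrix' (PL R ∘ₗ ι)
  have hD : ∀ R w, D R *ᵥ w = PL R (ι w) := fun R w => by
    rw [← Matrix.toLin'_apply, Matrix.toLin'_toMatrix']; rfl
  have hDc : Continuous D := continuous_matrix fun p q => by
    have : ∀ R, D R p q = PL R (ι (Pi.single q 1)) p := fun R => LinearMap.toMatrix'_apply ..
    simp only [this]
    exact (continuous_apply p).comp (hPL _)
  have hDM : D M = 1 := by
    have : PL M ∘ₗ ι = LinearMap.id := LinearMap.ext fun w => funext fun p => hf p w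
    rw [← LinearMap.toMatrix'_id, ← this]
  -- The projection of the identity along `C` onto the kernel of `PL R`, given by Cramer's rule and
  -- hence continuous where `D R` is invertible.
  let s : ArrowSpace Q d → V := fun R => 1 - ι ((D R)⁻¹ *ᵥ PL R 1)
  refine ⟨{R : ArrowSpace Q d | (D R).det ≠ 0},
    isOpen_ne_fun hDc.matrix_det continuous_const, ?_, s, ?_, ?_, ?_⟩
  · change (D M).det ≠ 0
    rw [hDM]; simp
  · refine continuousOn_const.sub ?_
    refine (LinearMap.continuous_of_finiteDimensional ι).comp_continuousOn ?_
    have hinv : ContinuousOn (fun R => (D R)⁻¹) {R : ArrowSpace Q d | (D R).det ≠ 0} := by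
      simp only [Matrix.inv_def, Ring.inverse_eq_inv']
      exact (hDc.matrix_det.continuousOn.inv₀ fun R hR => hR).smul hDc.matrix_adjugate.continuousOn
    rw [continuousOn_iff_continuous_domRestrict] at hinv ⊢
    exact hinv.matrix_mulVec ((hPL 1).comp continuous_subtype_val)
  · have h1 : homDefect M M 1 = 0 := by
      funext i j a
      simp [homDefect_apply]
    have h2 : PL M 1 = 0 := by
      change LinearMap.pi _ (homDefect M M 1) = 0
      rw [h1, map_zero]
    simp [s, h2]
  · intro R hg h3
    have hu : IsUnit (D R).det := isUnit_iff_ne_zero.2 hg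
    have hsurj : Function.Surjective (PL R) := by
      intro w
      exact ⟨ι ((D R)⁻¹ *ᵥ w), by
        rw [← hD, Matrix.mulVec_mulVec, Matrix.mul_nonsing_inv _ hu, Matrix.one_mulVec]⟩
    have hs : s R ∈ LinearMap.ker (PL R) := by
      rw [LinearMap.mem_ker, map_sub, ← hD, Matrix.mulVec_mulVec, Matrix.mul_nonsing_inv _ hu,
        Matrix.one_mulVec, sub_self]
    have hle : LinearMap.ker (homDefect M R) ≤ LinearMap.ker (PL R) := by
      intro φ hφ
      rw [LinearMap.mem_ker] at hφ ⊢
      change LinearMap.pi _ (homDefect M R φ) = 0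
      rw [hφ, map_zero]
    -- As `PL R` is onto `ℂ^r`, its kernel has the dimension of End(M). It contains Hom(M, R), which
    -- is at least as large by assumption, so the two coincide and `s R` is a homomorphism.
    have hrank : Module.finrank ℂ (LinearMap.ker (PL R)) ≤
        Module.finrank ℂ (LinearMap.ker (homDefect M R)) := by
      have h1 := LinearMap.finrank_range_add_finrank_ker (PL R)
      rw [LinearMap.range_eq_top.2 hsurj, finrank_top, Module.finrank_fin_fun] at h1
      have h2 := Submodule.finrank_add_eq_of_isCompl hC
      change _ + r = Module.finrank ℂ V at h2
      omega
    rw [← Submodule.eq_of_le_of_finrank_le hle hrank] at hs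
    exact LinearMap.mem_ker.1 hs

end QuiverRep

end

noncomputable section

open Topology

namespace QuiverRep

/-! ### The action of the universal cover of `GL_d` -/

variable {Q : Type u} [Quiver.{v} Q] {I : Set (PathAlgebraElement Q)} {d : Q → ℕ}

/-- The universal cover of `GL_d`. -/
abbrev GLCover (d : Q → ℕ) : Type u := ∀ j : Q, DetCover (Fin (d j))

/-- The covering homomorphism onto `GL_d`. -/
def GLCover.toGL : GLCover d →* GLd d where
  toFun x j := ⟨(x j).mat, ((x j)⁻¹).mat, (x j).mat_mul_mat_inv, (x j).mat_inv_mul_mat⟩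
  map_one' := by funext j; exact Units.ext rfl
  map_mul' x y := by funext j; exact Units.ext rfl

theorem GLCover.toGL_surjective : Function.Surjective (GLCover.toGL (d := d)) := by
  intro g
  have hdet : ∀ j, (g j).val.det ≠ 0 := fun j =>
    ((Matrix.isUnit_iff_isUnit_det _).1 (g j).isUnit).ne_zero
  exact ⟨fun j => DetCover.mk (g j).val (Complex.log (g j).val.det)
    (Complex.exp_log (hdet j)).symm, by funext j; exact Units.ext rfl⟩

/-- The matrices underlying an element of the cover. -/
def GLCover.mats (x : GLCover d) : ∀ j, Matrix (Fin (d j)) (Fin (d j)) ℂ := fun j => (x j).mat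

theorem GLCover.continuous_mats : Continuous (GLCover.mats (d := d)) :=
  continuous_pi fun j => DetCover.continuous_mat.comp (continuous_apply j)

instance (M : Rep I d) : MulAction (GLCover d) (MulAction.orbit (GLd d) M) :=
  MulAction.compHom _ GLCover.toGL

theorem GLCover.smul_apply {M : Rep I d} (x : GLCover d) (y : MulAction.orbit (GLd d) M)
    (i j : Q) (a : i ⟶ j) :
    (x • y).1.1 i j a = (x j).mat * y.1.1 i j a * ((x i)⁻¹).mat := rfl

theorem continuous_apply_arrow {i j : Q} (a : i ⟶ j) :
    Continuous fun R : RepSpace Q d => R i j a := by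
  have : Continuous fun R : ArrowSpace Q d => R i j a :=
    (continuous_apply a).comp ((continuous_apply j).comp (continuous_apply i))
  exact this

theorem continuous_orbit {Y : Type*} [TopologicalSpace Y] {M : Rep I d}
    {f : Y → MulAction.orbit (GLd d) M}
    (hf : ∀ (i j : Q) (a : i ⟶ j), Continuous fun y => (f y).1.1 i j a) : Continuous f := by
  refine continuous_induced_rng.2 (continuous_induced_rng.2 ?_)
  have : Continuous fun y => (((f y).1.1 : RepSpace Q d) : ArrowSpace Q d) :=
    continuous_pi fun i => continuous_pi fun j => continuous_pi fun a => hf i j a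
  exact this

instance (M : Rep I d) : ContinuousConstSMul (GLCover d) (MulAction.orbit (GLd d) M) where
  continuous_const_smul x := continuous_orbit fun i j a => by
    simp only [GLCover.smul_apply]
    have : Continuous fun y : MulAction.orbit (GLd d) M => y.1.1 i j a :=
      (continuous_apply_arrow a).comp (continuous_subtype_val.comp continuous_subtype_val)
    exact (continuous_const.matrix_mul this).matrix_mul continuous_const

theorem continuous_smul_point {M : Rep I d} (y : MulAction.orbit (GLd d) M) :
    Continuous fun x : GLCover d => x • y := continuous_orbit fun i j a => by
  simp only [GLCover.smul_apply]
  have h1 : Continuous fun x : GLCover d => (x j).mat :=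
    DetCover.continuous_mat.comp (continuous_apply j)
  have h2 : Continuous fun x : GLCover d => ((x i)⁻¹).mat :=
    DetCover.continuous_mat.comp (continuous_apply i).inv
  exact (h1.matrix_mul continuous_const).matrix_mul h2

instance (M : Rep I d) : MulAction.IsPretransitive (GLCover d) (MulAction.orbit (GLd d) M) where
  exists_smul_eq y z := by
    obtain ⟨g, hg⟩ := MulAction.exists_smul_eq (GLd d) y z
    obtain ⟨x, rfl⟩ := GLCover.toGL_surjective g
    exact ⟨x, hg⟩

/-- The representation as a point of its orbit. -/
def orbitPoint (M : Rep I d) : MulAction.orbit (GLd d) M := ⟨M, MulAction.mem_orbit_self M⟩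

theorem smul_orbitPoint_eq_iff {M : Rep I d} (x : GLCover d) (y : MulAction.orbit (GLd d) M) :
    x • orbitPoint M = y ↔
      ∀ (i j : Q) (a : i ⟶ j), (x j).mat * M.1 i j a = y.1.1 i j a * (x i).mat := by
  constructor
  · rintro rfl i j a
    rw [GLCover.smul_apply, Matrix.mul_assoc _ _ (x i).mat, DetCover.mat_inv_mul_mat,
      Matrix.mul_one]
    rfl
  · intro h
    refine Subtype.ext (Subtype.ext ?_)
    funext i j a
    rw [GLCover.smul_apply]
    change (x j).mat * M.1 i j a * _ = _
    rw [h, Matrix.mul_assoc, DetCover.mat_mul_mat_inv, Matrix.mul_one]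

theorem smul_orbitPoint_eq_self_iff {M : Rep I d} (x : GLCover d) :
    x • orbitPoint M = orbitPoint M ↔ IsEndo M x.mats := by
  rw [smul_orbitPoint_eq_iff, isEndo_iff]
  rfl

/-- Near `M`, the continuous homomorphism from `M` to `R` is close to the identity, so its
determinants lie in the slit plane. It is therefore invertible, and principal logarithms lift it to
the cover. -/
theorem hasLocalSection_orbitPoint [Finite Q] (M : Rep I d) :
    HasLocalSection (GLCover d) (orbitPoint M) := by
  classical
  obtain ⟨U, hU, hMU, s, hs, hsM, hsU⟩ := exists_continuous_hom (M.1 : ArrowSpace Q d)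
  let S : Set (∀ j, Matrix (Fin (d j)) (Fin (d j)) ℂ) :=
    {A | ∀ j, (A j).det ∈ Complex.slitPlane}
  have hS : IsOpen S := by
    have : S = ⋂ j, {A | (A j).det ∈ Complex.slitPlane} := by ext A; simp [S]
    rw [this]
    exact isOpen_iInter_of_finite fun j =>
      Complex.isOpen_slitPlane.preimage (continuous_apply j).matrix_det
  have hdet : ∀ {A}, A ∈ S → ∀ j, (A j).det ≠ 0 := fun {A} hA j =>
    Complex.slitPlane_ne_zero (hA j)
  let lift : (∀ j, Matrix (Fin (d j)) (Fin (d j)) ℂ) → GLCover d := fun A =>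
    if h : A ∈ S then fun j => DetCover.mk (A j) (Complex.log (A j).det)
      (Complex.exp_log (hdet h j)).symm else 1
  have hlift : ∀ A ∈ S, ∀ j, (lift A j).mat = A j := by
    intro A hA j
    simp only [lift, dif_pos hA, DetCover.mat_mk]
  have hliftc : ContinuousOn lift S := by
    rw [continuousOn_iff_continuous_domRestrict]
    refine continuous_pi fun j => DetCover.continuous_of ?_ ?_
    · have : ∀ A : S, (S.domRestrict lift A j).mat = A.1 j := fun A => hlift A.1 A.2 j
      simp only [this]
      exact (continuous_apply j).comp continuous_subtype_val
    · have : ∀ A : S, (S.domRestrict lift A j).logDet = Complex.log (A.1 j).det := by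
        rintro ⟨A, hA⟩
        simp only [Set.domRestrict_apply, lift, dif_pos hA, DetCover.logDet_mk]
      simp only [this]
      exact ((continuous_apply j).comp continuous_subtype_val).matrix_det.clog fun A => A.2 j
  have hval : Continuous fun y : MulAction.orbit (GLd d) M =>
      ((y.1.1 : RepSpace Q d) : ArrowSpace Q d) :=
    (continuous_subtype_val (p := SatisfiesRelations I)).comp continuous_subtype_val
  refine ⟨{y | (y.1.1 : ArrowSpace Q d) ∈ U ∩ s ⁻¹' S}, ?_, fun y => lift (s y.1.1), ?_, ?_⟩
  · refine ((hs.isOpen_inter_preimage hU hS).preimage hval).mem_nhds ⟨hMU, ?_⟩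
    change s M.1 ∈ S
    rw [hsM]
    intro j
    simp
  · exact hliftc.comp (hs.comp hval.continuousOn fun y hy => hy.1) fun y hy => hy.2
  · rintro y ⟨hyU, hyS⟩
    rw [smul_orbitPoint_eq_iff]
    intro i j a
    rw [hlift _ hyS, hlift _ hyS]
    obtain ⟨g, hg⟩ := y.2
    have hg' : y.1.1 = g • M.1 := congrArg Subtype.val hg.symm
    have h := hsU y.1.1 hyU (by
      rw [hg']
      exact finrank_ker_homDefect_le M.1 g)
    exact sub_eq_zero.1 (congrFun (congrFun (congrFun h i) j) a)

/-! ### The identity component of the stabilizer -/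

namespace IsDecomposition

variable {M : Rep I d} {k : ℕ} {β : Fin k → Q → ℕ} {N : ∀ i, Rep I (β i)} {m : Fin k → ℕ}
  (hN : IsDecomposition M N m)

/-- The identity component of the stabilizer in the universal cover of `GL_d`: automorphisms with
logarithms of the determinants induced by logarithms of the characters. -/
def stabComponent : Subgroup (GLCover d) where
  carrier := {x | IsEndo M x.mats ∧ ∃ ζ : Fin k → ℂ, (∀ i, Complex.exp (ζ i) = hN.char i x.mats) ∧
    ∀ j, (x j).logDet = ∑ i, β i j * ζ i}
  one_mem' := ⟨IsEndo.one M, 0, fun i => by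
    rw [Pi.zero_apply, Complex.exp_zero]; exact (hN.char_one i).symm, fun j => by simp⟩
  mul_mem' := by
    rintro x y ⟨hx, ζ, hζ, hxζ⟩ ⟨hy, ξ, hξ, hyξ⟩
    refine ⟨hx.mul hy, ζ + ξ, fun i => ?_, fun j => ?_⟩
    · rw [Pi.add_apply, Complex.exp_add, hζ, hξ]
      exact (hN.char_mul hx hy i).symm
    · rw [Pi.mul_apply, DetCover.logDet_mul, hxζ, hyξ, ← Finset.sum_add_distrib]
      exact Finset.sum_congr rfl fun i _ => by rw [Pi.add_apply, mul_add]
  inv_mem' := by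
    rintro x ⟨hx, ζ, hζ, hxζ⟩
    have hx' : IsEndo M (x⁻¹).mats := by
      rw [← smul_orbitPoint_eq_self_iff] at hx ⊢
      rw [inv_smul_eq_iff, hx]
    refine ⟨hx', -ζ, fun i => ?_, fun j => ?_⟩
    · have h := hN.char_mul hx hx' i
      have h1 : (fun j => x.mats j * (x⁻¹).mats j) = fun _ => 1 :=
        funext fun j => (x j).mat_mul_mat_inv
      rw [h1, hN.char_one] at h
      rw [Pi.neg_apply, Complex.exp_neg, hζ]
      exact inv_eq_of_mul_eq_one_right h.symm
    · rw [Pi.inv_apply, DetCover.logDet_inv, hxζ, ← Finset.sum_neg_distrib]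
      exact Finset.sum_congr rfl fun i _ => by rw [Pi.neg_apply, mul_neg]

theorem mem_stabComponent {x : GLCover d} : x ∈ hN.stabComponent ↔ IsEndo M x.mats ∧
    ∃ ζ : Fin k → ℂ, (∀ i, Complex.exp (ζ i) = hN.char i x.mats) ∧
      ∀ j, (x j).logDet = ∑ i, β i j * ζ i := Iff.rfl

theorem char_ne_zero {x : GLCover d} (hx : IsEndo M x.mats) (i : Fin k) :
    hN.char i x.mats ≠ 0 := by
  have hx' : IsEndo M (x⁻¹).mats := by
    rw [← smul_orbitPoint_eq_self_iff] at hx ⊢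
    rw [inv_smul_eq_iff, hx]
  have h := hN.char_mul hx hx' i
  have h1 : (fun j => x.mats j * (x⁻¹).mats j) = fun _ => 1 :=
    funext fun j => (x j).mat_mul_mat_inv
  rw [h1, hN.char_one] at h
  exact left_ne_zero_of_mul_eq_one h.symm

theorem exp_sum_eq_prod (b : Fin k → ℕ) (ζ : Fin k → ℂ) :
    Complex.exp (∑ i, b i * ζ i) = ∏ i, Complex.exp (ζ i) ^ b i := by
  rw [Complex.exp_sum]
  exact Finset.prod_congr rfl fun i _ => Complex.exp_nat_mul _ _

/-- The determinant is a polynomial in `τ` with value 1 at 0. -/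
theorem finite_det_one_add_smul_eq_zero {n : Type*} [Fintype n] [DecidableEq n]
    (B : Matrix n n ℂ) : {τ : ℂ | (1 + τ • B).det = 0}.Finite := by
  let p : Polynomial ℂ := (1 + (Polynomial.X : Polynomial ℂ) • B.map Polynomial.C).det
  have hp : ∀ τ, p.eval τ = (1 + τ • B).det := by
    intro τ
    change Polynomial.evalRingHom τ p = _
    rw [RingHom.map_det]
    congr 1
    ext r c
    simp [Matrix.one_apply, apply_ite (Polynomial.eval τ)]
    exact mul_comm _ _
  have hp0 : p ≠ 0 := fun h => by
    have := hp 0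
    simp [h] at this
  refine (p.roots.toFinset.finite_toSet).subset fun τ hτ => ?_
  simp only [Finset.mem_coe, Multiset.mem_toFinset, Polynomial.mem_roots hp0, Polynomial.IsRoot]
  rw [hp]
  exact hτ

/-- An automorphism with logarithms of its characters, as an element of the stabilizer. -/
def ofChar (A : ∀ j, Matrix (Fin (d j)) (Fin (d j)) ℂ) (hA : IsEndo M A)
    (ζ : Fin k → ℂ) (h : ∀ i, Complex.exp (ζ i) = hN.char i A) : GLCover d := fun j =>
  DetCover.mk (A j) (∑ i, β i j * ζ i) (by
    rw [hN.det_eq_prod_char hA, exp_sum_eq_prod]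
    simp only [h])

theorem ofChar_mem {A : ∀ j, Matrix (Fin (d j)) (Fin (d j)) ℂ} (hA : IsEndo M A)
    (ζ : Fin k → ℂ) (h : ∀ i, Complex.exp (ζ i) = hN.char i A) :
    hN.ofChar A hA ζ h ∈ hN.stabComponent := ⟨hA, ζ, h, fun _ => rfl⟩

theorem eq_ofChar {x : GLCover d} (hx : IsEndo M x.mats) (ζ : Fin k → ℂ)
    (h : ∀ i, Complex.exp (ζ i) = hN.char i x.mats)
    (h' : ∀ j, (x j).logDet = ∑ i, β i j * ζ i) : x = hN.ofChar x.mats hx ζ h :=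
  funext fun j => DetCover.ext rfl (h' j)

theorem ofChar_congr {A A' : ∀ j, Matrix (Fin (d j)) (Fin (d j)) ℂ} {hA : IsEndo M A}
    {hA' : IsEndo M A'} {ζ ζ' : Fin k → ℂ} {h : ∀ i, Complex.exp (ζ i) = hN.char i A}
    {h' : ∀ i, Complex.exp (ζ' i) = hN.char i A'} (e : A = A') (e' : ζ = ζ') :
    hN.ofChar A hA ζ h = hN.ofChar A' hA' ζ' h' := by
  subst e e'
  rfl

theorem joinedIn_ofChar {A A' : ∀ j, Matrix (Fin (d j)) (Fin (d j)) ℂ} {hA : IsEndo M A}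
    {hA' : IsEndo M A'} {ζ ζ' : Fin k → ℂ} {h : ∀ i, Complex.exp (ζ i) = hN.char i A}
    {h' : ∀ i, Complex.exp (ζ' i) = hN.char i A'}
    (Γ : unitInterval → ∀ j, Matrix (Fin (d j)) (Fin (d j)) ℂ) (hΓ : ∀ j, Continuous fun t => Γ t j)
    (ξ : unitInterval → Fin k → ℂ) (hξ : Continuous ξ) (hE : ∀ t, IsEndo M (Γ t))
    (hc : ∀ t i, Complex.exp (ξ t i) = hN.char i (Γ t)) (e0 : Γ 0 = A) (e1 : Γ 1 = A')
    (e0' : ξ 0 = ζ) (e1' : ξ 1 = ζ') :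
    JoinedIn (hN.stabComponent : Set (GLCover d)) (hN.ofChar A hA ζ h)
      (hN.ofChar A' hA' ζ' h') := by
  refine ⟨⟨⟨fun t => hN.ofChar (Γ t) (hE t) (ξ t) (hc t), ?_⟩,
    hN.ofChar_congr (hA := hE 0) (h := hc 0) e0 e0',
    hN.ofChar_congr (hA := hE 1) (h := hc 1) e1 e1'⟩, fun t => hN.ofChar_mem (hE t) (ξ t) (hc t)⟩
  refine continuous_pi fun j => DetCover.continuous_of (hΓ j) ?_
  change Continuous fun t => ∑ i, (β i j : ℂ) * ξ t i
  exact continuous_finsetSum _ fun i _ => continuous_const.mul ((continuous_apply i).comp hξ)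

theorem isPathConnected_stabComponent [Finite Q] :
    IsPathConnected (hN.stabComponent : Set (GLCover d)) := by
  refine ⟨1, hN.stabComponent.one_mem, fun {x} hx => ?_⟩
  obtain ⟨hxE, ζ, hζ, hxζ⟩ := hx
  have h1 : (1 : GLCover d) = hN.ofChar (fun _ => 1) (IsEndo.one M) 0
      (fun i => by rw [Pi.zero_apply, Complex.exp_zero, hN.char_one]) :=
    funext fun j => DetCover.ext rfl (by simp [ofChar])
  -- The torus weight exp(-tζ_i) scales the logarithms of the characters linearly to 0, joining `x`
  -- to an automorphism with all characters 1 and zero logarithms.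
  let z : unitInterval → Fin k → ℂ := fun t i => Complex.exp (-((t : ℝ) * ζ i))
  have hz : Continuous z := continuous_pi fun i => by fun_prop
  let Γ₁ : unitInterval → ∀ j, Matrix (Fin (d j)) (Fin (d j)) ℂ := fun t j =>
    x.mats j * hN.torus (z t) j
  have hΓ₁ : ∀ t, IsEndo M (Γ₁ t) := fun t => hxE.mul (hN.isEndo_torus _)
  have hchar₁ : ∀ (t : unitInterval) i, Complex.exp (((1 - (t : ℝ) : ℝ) : ℂ) * ζ i) = hN.char i (Γ₁ t) := by
    intro t i
    rw [hN.char_mul hxE (hN.isEndo_torus _), hN.char_torus, ← hζ, ← Complex.exp_add]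
    congr 1
    push_cast
    ring
  have hA : ∀ i, Complex.exp ((0 : Fin k → ℂ) i) = hN.char i (Γ₁ 1) := fun i => by
    rw [← hchar₁]; simp
  have step₁ : JoinedIn (hN.stabComponent : Set (GLCover d)) x (hN.ofChar (Γ₁ 1) (hΓ₁ 1) 0 hA) := by
    rw [hN.eq_ofChar hxE ζ hζ hxζ]
    refine hN.joinedIn_ofChar Γ₁ (fun j => ?_) (fun t i => ((1 - (t : ℝ) : ℝ) : ℂ) * ζ i) ?_ hΓ₁
      hchar₁ ?_ rfl ?_ ?_
    · exact continuous_const.matrix_mul ((hN.continuous_torus j).comp hz)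
    · exact continuous_pi fun i => by fun_prop
    · have : z 0 = 1 := funext fun i => by simp [z]
      funext j
      simp only [Γ₁, this, hN.torus_one, mul_one]
    · funext i; simp
    · funext i; simp
  refine JoinedIn.symm (step₁.trans (JoinedIn.symm ?_))
  rw [h1]
  set A := Γ₁ 1 with hAdef
  have hAE : IsEndo M A := hΓ₁ 1
  have hA1 : ∀ i, hN.char i A = 1 := fun i => by rw [← hA]; simp
  -- The complex line from 1 to `A` consists of endomorphisms; its characters vanish at only
  -- finitely many parameters, which a path from 0 to 1 in ℂ avoids.
  let L : ℂ → ∀ j, Matrix (Fin (d j)) (Fin (d j)) ℂ := fun τ j => 1 + τ • (A j - 1)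
  have hLE : ∀ τ, IsEndo M (L τ) := by
    intro τ
    have := (IsHom.id M).add ((IsHom.sub hAE (IsHom.id M)).smul τ)
    have h : (fun j => Matrix.toLin' (L τ j)) = (fun _ => LinearMap.id : LinMaps d d) +
        τ • ((fun j => Matrix.toLin' (A j)) - fun _ => LinearMap.id) := by
      funext j
      simp [L]
    rwa [IsEndo, h]
  let bad : Set ℂ := {τ | ∃ i, hN.char i (L τ) = 0}
  have hbad : bad.Finite := by
    have : bad = ⋃ i, {τ | hN.char i (L τ) = 0} := by ext τ; simp [bad]
    rw [this]
    refine Set.finite_iUnion fun i => ?_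
    refine (finite_det_one_add_smul_eq_zero (hN.multMatrix i (fun j => Matrix.toLin' (A j)) - 1)
      ).subset fun τ hτ => ?_
    have h : (fun j => Matrix.toLin' (L τ j)) = (fun _ => LinearMap.id : LinMaps d d) +
        τ • ((fun j => Matrix.toLin' (A j)) - fun _ => LinearMap.id) := by
      funext j
      simp [L]
    have hτ' : hN.char i (L τ) = 0 := hτ
    rwa [char, h, map_add, map_smul, map_sub, hN.multMatrix_id] at hτ'
  have hL0 : L 0 = fun _ => 1 := funext fun j => by simp [L]
  have hL1 : L 1 = A := funext fun j => by simp [L]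
  obtain ⟨τ, hτ⟩ := (hbad.countable.isPathConnected_compl_of_one_lt_rank
    (by rw [Complex.rank_real_complex]; exact_mod_cast one_lt_two)).joinedIn 0 (by
      rintro ⟨i, hi⟩; rw [hL0, hN.char_one] at hi; exact one_ne_zero hi) 1 (by
      rintro ⟨i, hi⟩; rw [hL1, hA1] at hi; exact one_ne_zero hi)
  have hτ0 : ∀ t i, hN.char i (L (τ t)) ≠ 0 := fun t i h => hτ t ⟨i, h⟩
  -- Multiplying by the torus with inverse characters restores all characters to 1 along the path,
  -- so the logarithms can remain 0.
  let w : unitInterval → Fin k → ℂ := fun t i => (hN.char i (L (τ t)))⁻¹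
  have hLc : Continuous fun t => L (τ t) := continuous_pi fun j =>
    continuous_const.add (τ.continuous.smul continuous_const)
  have hw : Continuous w := continuous_pi fun i =>
    ((hN.continuous_char i).comp hLc).inv₀ fun t => hτ0 t i
  refine hN.joinedIn_ofChar (fun t j => L (τ t) j * hN.torus (w t) j) (fun j => ?_) (fun _ => 0)
    continuous_const (fun t => (hLE _).mul (hN.isEndo_torus _)) (fun t i => ?_) ?_ ?_ rfl rfl
  · exact ((continuous_apply j).comp hLc).matrix_mul ((hN.continuous_torus j).comp hw)
  · rw [hN.char_mul (hLE _) (hN.isEndo_torus _), hN.char_torus, Pi.zero_apply, Complex.exp_zero]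
    exact (mul_inv_cancel₀ (hτ0 t i)).symm
  · have : w 0 = 1 := funext fun i => by simp [w, hL0, hN.char_one]
    funext j
    simp only [this, hN.torus_one, mul_one, τ.source, hL0]
  · have : w 1 = 1 := funext fun i => by simp [w, hL1, hA1]
    funext j
    simp only [this, hN.torus_one, mul_one, τ.target, hL1]
    rfl

end IsDecomposition

/-! ### The central kernel and its intersection with the stabilizer component. -/

/-- The kernel of the covering of `GL_d`. -/
def centralLift (d : Q → ℕ) (n : Q → ℤ) : GLCover d := fun j =>
  DetCover.mk 1 (n j * (2 * Real.pi * Complex.I)) (by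
    rw [Matrix.det_one, Complex.exp_int_mul_two_pi_mul_I])

theorem centralLift_add (n n' : Q → ℤ) :
    centralLift d (n + n') = centralLift d n * centralLift d n' :=
  funext fun j => DetCover.ext (Matrix.mul_one 1).symm (by simp [centralLift, add_mul])

theorem centralLift_comm (n : Q → ℤ) (x : GLCover d) : centralLift d n * x = x * centralLift d n :=
  funext fun j => DetCover.ext (by simp [centralLift]) (by simp [centralLift, add_comm])

theorem mats_mul_centralLift (x : GLCover d) (n : Q → ℤ) : (x * centralLift d n).mats = x.mats :=
  funext fun _ => Matrix.mul_one _

theorem dimensionMap_apply {k : ℕ} (β : Fin k → Q → ℕ) (l : Fin k → ℤ) (j : Q) :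
    dimensionMap β l j = ∑ i, β i j * l i := by
  simp [dimensionMap, Matrix.mulVec, dotProduct]

namespace IsDecomposition

variable {M : Rep I d} {k : ℕ} {β : Fin k → Q → ℕ} {N : ∀ i, Rep I (β i)} {m : Fin k → ℕ}
  (hN : IsDecomposition M N m)

/-- The identity has all characters 1, so the admissible logarithms are integer multiples of 2πi.
The induced logarithms of determinants are then 2πi times the image of the integer vector under `B`.
-/
theorem centralLift_mem_iff (n : Q → ℤ) :
    centralLift d n ∈ hN.stabComponent ↔ n ∈ LinearMap.range (dimensionMap β) := by
  have hpi : (2 * Real.pi * Complex.I : ℂ) ≠ 0 := Complex.two_pi_I_ne_zero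
  have hmats : (centralLift d n).mats = fun _ => 1 := rfl
  rw [mem_stabComponent, hmats]
  constructor
  · rintro ⟨-, ζ, hζ, h⟩
    have hl : ∀ i, ∃ l : ℤ, ζ i = l * (2 * Real.pi * Complex.I) := fun i =>
      Complex.exp_eq_one_iff.1 (by rw [hζ, hN.char_one])
    choose l hl using hl
    refine ⟨l, funext fun j => ?_⟩
    have hj : (n j : ℂ) * (2 * Real.pi * Complex.I) = ∑ i, β i j * ζ i := h j
    simp only [hl, ← mul_assoc (β _ j : ℂ), ← Finset.sum_mul] at hj
    have := mul_right_cancel₀ hpi hj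
    rw [dimensionMap_apply]
    exact_mod_cast this.symm
  · rintro ⟨l, rfl⟩
    refine ⟨IsEndo.one M, fun i => l i * (2 * Real.pi * Complex.I), fun i => ?_, fun j => ?_⟩
    · rw [hN.char_one, Complex.exp_int_mul_two_pi_mul_I]
    · change ((dimensionMap β l j : ℤ) : ℂ) * (2 * Real.pi * Complex.I) = _
      rw [dimensionMap_apply]
      push_cast
      rw [Finset.sum_mul]
      exact Finset.sum_congr rfl fun i _ => by ring

/-- By the determinant formula, the chosen logarithms and those induced by the characters have equal
exponentials; they differ by 2πi times an integer at each vertex. -/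
theorem smul_orbitPoint_eq_self_iff_exists (x : GLCover d) :
    x • orbitPoint M = orbitPoint M ↔ ∃ n : Q → ℤ, x * centralLift d n ∈ hN.stabComponent := by
  rw [smul_orbitPoint_eq_self_iff]
  constructor
  · intro hx
    have hζ : ∀ i, Complex.exp (Complex.log (hN.char i x.mats)) = hN.char i x.mats :=
      fun i => Complex.exp_log (hN.char_ne_zero hx i)
    have hn : ∀ j, ∃ n : ℤ, (∑ i, β i j * Complex.log (hN.char i x.mats)) =
        (x j).logDet + n * (2 * Real.pi * Complex.I) := fun j => by
      rw [← Complex.exp_eq_exp_iff_exists_int, exp_sum_eq_prod, ← DetCover.det_mat]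
      simp only [hζ]
      exact (hN.det_eq_prod_char hx j).symm
    choose n hn using hn
    refine ⟨n, ?_⟩
    rw [mem_stabComponent, mats_mul_centralLift]
    exact ⟨hx, _, hζ, fun j => (hn j).symm⟩
  · rintro ⟨n, hn⟩
    rw [mem_stabComponent, mats_mul_centralLift] at hn
    exact hn.1

/-- On the stabilizer, `G j` takes values in 2πiℤ. It is continuous at 1 with value 0, so norm less
than 2π forces it to vanish there. -/
theorem exists_nhds_subset_stabComponent [Finite Q] : ∃ U ∈ 𝓝 (1 : GLCover d), ∀ x ∈ U,
    x • orbitPoint M = orbitPoint M → x ∈ hN.stabComponent := by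
  let G : Q → GLCover d → ℂ := fun j x =>
    (x j).logDet - ∑ i, β i j * Complex.log (hN.char i x.mats)
  have hchar1 : ∀ i, hN.char i (1 : GLCover d).mats = 1 := hN.char_one
  have hG : ∀ j, ContinuousAt (G j) 1 := by
    intro j
    refine (DetCover.continuous_logDet.comp (continuous_apply j)).continuousAt.sub ?_
    refine tendsto_finsetSum _ fun i _ => ContinuousAt.mul continuousAt_const ?_
    refine ContinuousAt.clog
      ((hN.continuous_char i).comp GLCover.continuous_mats).continuousAt ?_
    rw [hchar1]
    exact Complex.one_mem_slitPlane
  have hG1 : ∀ j, G j 1 = 0 := fun j => by simp [G, hchar1]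
  refine ⟨{x | ∀ j, ‖G j x‖ < 2 * Real.pi}, Filter.eventually_all.2 fun j => ?_, fun x hx hstab => ?_⟩
  · refine (hG j).norm.eventually_lt continuousAt_const ?_
    rw [hG1, norm_zero]
    exact Real.two_pi_pos
  · rw [smul_orbitPoint_eq_self_iff] at hstab
    have hζ : ∀ i, Complex.exp (Complex.log (hN.char i x.mats)) = hN.char i x.mats :=
      fun i => Complex.exp_log (hN.char_ne_zero hstab i)
    refine ⟨hstab, _, hζ, fun j => ?_⟩
    have hexp : Complex.exp (x j).logDet =
        Complex.exp (∑ i, β i j * Complex.log (hN.char i x.mats)) := by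
      rw [exp_sum_eq_prod, ← DetCover.det_mat]
      simp only [hζ]
      exact hN.det_eq_prod_char hstab j
    obtain ⟨n, hn⟩ := Complex.exp_eq_exp_iff_exists_int.1 hexp
    have hGn : G j x = n * (2 * Real.pi * Complex.I) := by
      simp only [G, hn, add_sub_cancel_left]
    have hlt : ‖G j x‖ < 2 * Real.pi := hx j
    have hn0 : n = 0 := by
      rw [hGn, norm_mul, Complex.norm_intCast] at hlt
      have : ‖(2 * Real.pi * Complex.I : ℂ)‖ = 2 * Real.pi := by
        simp [abs_of_pos Real.pi_pos]
      rw [this] at hlt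
      have h2 : |(n : ℝ)| < 1 := by
        by_contra! hc
        nlinarith [Real.two_pi_pos]
      rw [← Int.abs_lt_one_iff]
      exact_mod_cast h2
    rw [hn, hn0]
    simp

/-- The fundamental group of the orbit is the cokernel of the dimension map. -/
theorem nonempty_fundamentalGroup_equiv [Finite Q] (hN : IsDecomposition M N m) (hd : IsSincere d)
    (x : MulAction.orbit (GLd d) M) :
    Nonempty (FundamentalGroup (MulAction.orbit (GLd d) M) x ≃*
      Multiplicative (DimensionCokernel β)) := by
  -- Sincerity enters here: for `d j = 0` the space is the discrete set 2πiℤ, which is not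
  -- connected.
  have : ∀ j, SimplyConnectedSpace (DetCover (Fin (d j))) := fun j =>
    DetCover.simplyConnectedSpace_fin (d j) (hd j)
  exact (hasLocalSection_orbitPoint M).nonempty_fundamentalGroup_equiv
    (continuous_smul_point _) hN.isPathConnected_stabComponent (LinearMap.range (dimensionMap β))
    (centralLift d) centralLift_add centralLift_comm hN.centralLift_mem_iff
    hN.smul_orbitPoint_eq_self_iff_exists hN.exists_nhds_subset_stabComponent x

end IsDecomposition

/-- Describes the image by the set of dimension vectors alone, so order and repetitions of the `β i`
do not affect the cokernel. -/
theorem range_dimensionMap_eq_span {k : ℕ} (β : Fin k → Q → ℕ) :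
    LinearMap.range (dimensionMap β) =
      Submodule.span ℤ ((fun (b : Q → ℕ) (j : Q) => (b j : ℤ)) '' Set.range β) := by
  rw [dimensionMap, Matrix.range_mulVecLin, ← Set.range_comp]
  rfl

end QuiverRep

end

theorem proposition2 {Q : Type u} [Quiver.{v} Q] [Finite Q]
    (I : Set (QuiverRep.PathAlgebraElement Q))
    (d : Q → ℕ) (hd : QuiverRep.IsSincere d) (M : QuiverRep.Rep I d)
    {k : ℕ} (β : Fin k → Q → ℕ) (N : ∀ i, QuiverRep.Rep I (β i)) (m : Fin k → ℕ)
    (hN : QuiverRep.IsDecomposition M N m)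
    (x : MulAction.orbit (QuiverRep.GLd d) M) :
    Nonempty (FundamentalGroup (MulAction.orbit (QuiverRep.GLd d) M) x ≃*
      Multiplicative (QuiverRep.DimensionCokernel β)) ∧
    (∀ γ δ : FundamentalGroup (MulAction.orbit (QuiverRep.GLd d) M) x, γ * δ = δ * γ) ∧
    (∀ (d' : Q → ℕ) (_ : QuiverRep.IsSincere d') (M' : QuiverRep.Rep I d')
      (k' : ℕ) (β' : Fin k' → Q → ℕ) (N' : ∀ i, QuiverRep.Rep I (β' i)) (m' : Fin k' → ℕ)
      (_ : QuiverRep.IsDecomposition M' N' m')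
      (x' : MulAction.orbit (QuiverRep.GLd d') M'),
      Set.range β = Set.range β' →
        Nonempty (FundamentalGroup (MulAction.orbit (QuiverRep.GLd d) M) x ≃*
          FundamentalGroup (MulAction.orbit (QuiverRep.GLd d') M') x')) := by
  obtain ⟨e⟩ := hN.nonempty_fundamentalGroup_equiv hd x
  refine ⟨⟨e⟩, fun γ δ => e.injective ?_, ?_⟩
  · rw [map_mul, map_mul, mul_comm]
  · intro d' hd' M' k' β' N' m' hN' x' hβ
    obtain ⟨e'⟩ := hN'.nonempty_fundamentalGroup_equiv hd' x'
    have hr : LinearMap.range (QuiverRep.dimensionMap β) =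
        LinearMap.range (QuiverRep.dimensionMap β') := by
      rw [QuiverRep.range_dimensionMap_eq_span, QuiverRep.range_dimensionMap_eq_span, hβ]
    exact ⟨e.trans ((AddEquiv.toMultiplicative
      (Submodule.quotEquivOfEq _ _ hr).toAddEquiv).trans e'.symm)⟩
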